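/- Let $d,L\ge 0$ be integers. For each $m$, consider the fully connected ReLU network with $L$ hidden layers of width $m$ and scalar output, $$\alpha^{(0)}(\mathbf x)=\mathbf x\in\mathbb R^d,\qquad \alpha^{(l)}(\mathbf x)=\sqrt{\tfrac{2}{m}}\;\sigma\big(W^{(l)}\alpha^{(l-1)}(\mathbf x)\big)\ (1\le l\le L),\qquad f(\mathbf x)=W^{(L+1)}\alpha^{(L)}(\mathbf x),$$ where $\sigma(t)=\max\{0,t\}$ acts entrywise, $W^{(1)}\in\mathbb R^{m\times d}$, $W^{(l)}\in\mathbb R^{m\times m}$ for $2\le l\le L$, and $W^{(L+1)}$ is a row (of length $m$ if $L\ge1$, and $d$ if $L=0$). At initialization all entries of all the $W^{(l)}$ are i.i.d. $\mathcal N(0,1)$. Let $\nabla f(\mathbf x)$ be the gradient of $f(\mathbf x)$ with respect to all the parameters $W^{(1)},\dots,W^{(L+1)}$; let $\theta^{(l)}_m(\mathbf x,\mathbf z)$ be the angle between $\alpha^{(l)}(\mathbf x)$ and $\alpha^{(l)}(\mathbf z)$, and $\phi_m(\mathbf x,\mathbf z)$ the angle between $\nabla f(\mathbf x)$ and $\nabla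 f(\mathbf z)$, where the angle between two vectors is $\arccos\frac{\langle u,v\rangle}{\|u\|\|v\|}$, and $\pi/2$ if one of them is zero. Then, for every width $m$ and every $\mathbf x$, almost surely $f(\mathbf x)$ is differentiable in the parameters at initialization, and in the infinite-width limit $m\to\infty$ the following hold. (a) For all $\mathbf x,\mathbf z\in\mathbb R^d$ the angles $\theta^{(l)}_m(\mathbf x,\mathbf z)$, $0\le l\le L$, and $\phi_m(\mathbf x,\mathbf z)$ converge in probability to constants $\theta^{(l)}=\theta^{(l)}(\mathbf x,\mathbf z)$ and $\phi=\phi(\mathbf x,\mathbf z)$, and $$\cos\phi(\mathbf x,\mathbf z)=\frac1{L+1}\sum_{l=0}^{L}\left[\cos\theta^{(l)}(\mathbf x,\mathbf z)\prod_{l'=l}^{L-1}\left(1-\frac{\theta^{(l')}(\mathbf x,\mathbf z)}{\pi}\right)\right].$$ (b) For every $\mathbf x\in\mathbb R^d$, $\|\nabla f(\mathbf x)\|\to\sqrt{L+1}\,\|\mathbf x\|$ in probability, that is, $\|\nabla f(\mathbf x)\|^2=(L+1)\|\mathbf x\|^2$ in the limit. -/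

import Mathlib

open MeasureTheory ProbabilityTheory Filter Topology

noncomputable section

/-- Width `m_l` of layer `l`: the input layer has width `d`, every hidden layer has width `m`. -/
def layerWidth (d m : ℕ) : ℕ → ℕ
  | 0 => d
  | _ + 1 => m

/-- Indices of the scalar parameters: entries of the hidden weight matrices
`W^(l+1) ∈ ℝ^{m_{l+1} × m_l}` for `0 ≤ l < L`, and entries of the output row
`W^(L+1) ∈ ℝ^{1 × m_L}`. -/
abbrev ParamIndex (d m L : ℕ) : Type :=
  (Σ l : Fin L, Fin (layerWidth d m (l.val + 1)) × Fin (layerWidth d m l.val)) ⊕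
    Fin (layerWidth d m L)

/-- The collection of all parameters, as one Euclidean vector. -/
abbrev Param (d m L : ℕ) : Type := EuclideanSpace ℝ (ParamIndex d m L)

/-- The hidden weight matrix `W^(l+1)`, for `l < L` (it is not used, and set to `0`, for `l ≥ L`). -/
def hiddenWeight {d m L : ℕ} (w : Param d m L) (l : ℕ) :
    Matrix (Fin (layerWidth d m (l + 1))) (Fin (layerWidth d m l)) ℝ :=
  fun i j => if h : l < L then w (Sum.inl ⟨⟨l, h⟩, (i, j)⟩) else 0

/-- The output weights `W^(L+1)`, a row of length `m_L`. -/
def outputWeight {d m L : ℕ} (w : Param d m L) (j : Fin (layerWidth d m L)) : ℝ :=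
  w (Sum.inr j)

/-- The ReLU activation. -/
def relu (t : ℝ) : ℝ := max 0 t

/-- The `l`-embedding (`l ≤ L`): `α^(0)(x) = x` and
`α^(l+1)(x) = (√2 / √m_{l+1}) σ(W^(l+1) α^(l)(x))`. -/
def embedding {d m L : ℕ} (w : Param d m L) (x : EuclideanSpace ℝ (Fin d)) :
    (l : ℕ) → EuclideanSpace ℝ (Fin (layerWidth d m l))
  | 0 => x
  | l + 1 => WithLp.toLp 2 fun i =>
      Real.sqrt 2 / Real.sqrt (layerWidth d m (l + 1) : ℝ) *
        relu ((hiddenWeight w l).mulVec (embedding w x l) i)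

/-- The ReLU network with `L` hidden layers of width `m`: `f(w; x) = W^(L+1) α^(L)(x)`. -/
def reluNetwork (d m L : ℕ) (x : EuclideanSpace ℝ (Fin d)) (w : Param d m L) : ℝ :=
  ∑ j, outputWeight w j * embedding w x L j

/-- The model gradient `∇f(x) = ∂f/∂w`, the derivative in all the parameters. -/
def modelGradient {d m L : ℕ} (w : Param d m L) (x : EuclideanSpace ℝ (Fin d)) : Param d m L :=
  gradient (reluNetwork d m L x) w

/-- The `l`-embedding angle of the network with parameters `w`. -/
def embeddingAngle {d m L : ℕ} (w : Param d m L) (x z : EuclideanSpace ℝ (Fin d)) (l : ℕ) : ℝ :=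
  InnerProductGeometry.angle (embedding w x l) (embedding w z l)

/-- The model gradient angle of the network with parameters `w`. -/
def gradientAngle {d m L : ℕ} (w : Param d m L) (x z : EuclideanSpace ℝ (Fin d)) : ℝ :=
  InnerProductGeometry.angle (modelGradient w x) (modelGradient w z)

/-- The law of the parameters at initialization: all entries are i.i.d. `N(0, 1)`. -/
def initMeasure (d m L : ℕ) : Measure (Param d m L) :=
  (Measure.pi fun _ : ParamIndex d m L => gaussianReal 0 1).map (WithLp.toLp 2)

/-- For `X m` a real function of the parameters of the network of width `m`: at initialization,
`X m` tends to the constant `c` in probability as `m → ∞`. -/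
def TendstoInProbAtInit (d L : ℕ) (X : (m : ℕ) → Param d m L → ℝ) (c : ℝ) : Prop :=
  ∀ ε : ℝ, 0 < ε →
    Tendsto (fun m => initMeasure d m L {w | ε ≤ |X m w - c|}) atTop (𝓝 0)

end

/-! Given the layers below, the rows of one weight matrix are i.i.d. standard Gaussian vectors, so
an average over the `m` units of a layer lies within mean square `O(1/m)` of its conditional
expectation. That expectation involves the two embeddings only through their norms and angle,
because the joint law of two Gaussian inner products is determined by the Gram matrix
(`map_inner_pair_stdGaussian`). Hence `⟪α^(l+1)(x), α^(l+1)(z)⟫` tends to `‖x‖ ‖z‖ · 2κ(θ_l)` with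
`κ = reluKernel`. Since `2κ(0) = 1`, norms are preserved in the limit, and the angles follow the
recursion `θ_{l+1} = arccos (2κ(θ_l))`. No closed form of `κ` is needed: its continuity and its
value at `0` suffice.

For the gradients, let `Θ_l` be the matrix of inner products of the parameter gradients of the
entries of `α^(l)(x)` and `α^(l)(z)`. Each layer has its own weights, so cross terms vanish and
(`tangentKernel_succ`) `Θ_{l+1}(i,j) = (2/m) σ'_i σ'_j (δ_ij ⟪α^(l)(x), α^(l)(z)⟫ + W_i Θ_l W_jᵀ)`;
the inner product of the full gradients is `⟪α^(L)(x), α^(L)(z)⟫ + W Θ_L Wᵀ` with `W` the output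
row. By Isserlis' formula, `W_i Θ W_iᵀ` has mean `tr Θ` and variance at most `2 ‖Θ‖_F²`
(`integral_rowForm_sub_trace_sq_le`). So it suffices to follow two scalars: `‖Θ_l‖_F² → 0`, and `tr
Θ_l → ‖x‖ ‖z‖ T_l` with `T_{l+1} = (1 - θ_l/π)(cos θ_l + T_l)`. The factor `1 - θ_l/π` is twice the
probability that a unit is active on both inputs, an arc length in polar coordinates
(`planarGaussian_quadrant`). Unrolling the recursion gives the sum in the theorem; at angle `0` it
equals `L + 1`, which gives the gradient norms.

Conditioning on the lower layers is done by resampling one layer (`map_resample`) and applying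
Markov's inequality conditionally (`tendsto_zero_of_resample`). The chain-rule gradient is the true
one almost surely: a unit sits at the kink with positive probability only if its whole input layer
is zero, and then it stays zero nearby. -/

open scoped RealInnerProductSpace

/-! ### Moments and joint laws of inner products with a standard Gaussian vector. -/

section GaussianMoments

lemma integral_pow_two_gaussianReal : ∫ x, x ^ 2 ∂gaussianReal 0 1 = 1 := by
  have h := variance_fun_id_gaussianReal (μ := 0) (v := 1)
  rw [variance_eq_integral (by fun_prop)] at h
  simpa using h

/-- The function is the moment generating function of `N(0, 1)`, so this value is the fourth moment.
Each derivative is a polynomial times the same exponential. -/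
lemma iteratedDeriv_four_exp_sq :
    iteratedDeriv 4 (fun t : ℝ => Real.exp (t ^ 2 / 2)) 0 = 3 := by
  have hE : ∀ t : ℝ, HasDerivAt (fun t : ℝ => Real.exp (t ^ 2 / 2))
      (t * Real.exp (t ^ 2 / 2)) t := fun t => by
    have h := (((hasDerivAt_id t).pow 2).div_const 2).exp
    refine h.congr_deriv ?_
    simp; ring
  have h1 : deriv (fun t : ℝ => Real.exp (t ^ 2 / 2)) = fun t => t * Real.exp (t ^ 2 / 2) :=
    funext fun t => (hE t).deriv
  have h2 : deriv (fun t : ℝ => t * Real.exp (t ^ 2 / 2)) =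
      fun t => (1 + t ^ 2) * Real.exp (t ^ 2 / 2) := funext fun t => by
    have h : HasDerivAt (fun t : ℝ => t * Real.exp (t ^ 2 / 2)) _ t :=
      (hasDerivAt_id t).mul (hE t)
    rw [h.deriv]; simp; ring
  have h3 : deriv (fun t : ℝ => (1 + t ^ 2) * Real.exp (t ^ 2 / 2)) =
      fun t => (3 * t + t ^ 3) * Real.exp (t ^ 2 / 2) := funext fun t => by
    have h : HasDerivAt (fun t : ℝ => (1 + t ^ 2) * Real.exp (t ^ 2 / 2)) _ t :=
      (((hasDerivAt_id t).pow 2).const_add 1).mul (hE t)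
    rw [h.deriv]; simp; ring
  have h4 : deriv (fun t : ℝ => (3 * t + t ^ 3) * Real.exp (t ^ 2 / 2)) =
      fun t => (3 + 6 * t ^ 2 + t ^ 4) * Real.exp (t ^ 2 / 2) := funext fun t => by
    have h : HasDerivAt (fun t : ℝ => (3 * t + t ^ 3) * Real.exp (t ^ 2 / 2)) _ t :=
      (((hasDerivAt_id t).const_mul 3).add ((hasDerivAt_id t).pow 3)).mul (hE t)
    rw [h.deriv]; simp; ring
  rw [iteratedDeriv_eq_iterate]
  simp [Function.iterate_succ, h1, h2, h3, h4]

lemma integral_pow_four_gaussianReal : ∫ x, x ^ 4 ∂gaussianReal 0 1 = 3 := by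
  have h := iteratedDeriv_mgf_zero (X := fun x : ℝ => x) (μ := gaussianReal 0 1)
    (by rw [integrableExpSet_fun_id_gaussianReal]; simp) 4
  rw [mgf_fun_id_gaussianReal] at h
  simp only [NNReal.coe_one, zero_mul, zero_add, one_mul] at h
  rw [iteratedDeriv_four_exp_sq] at h
  exact h.symm

variable {E F : Type*} [NormedAddCommGroup E] [InnerProductSpace ℝ E] [FiniteDimensional ℝ E]
  [MeasurableSpace E] [BorelSpace E] [NormedAddCommGroup F] [InnerProductSpace ℝ F]
  [FiniteDimensional ℝ F] [MeasurableSpace F] [BorelSpace F]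


/-- A linear functional of the pair is again a single inner product, with the vector `L (1, 0) • c +
L (0, 1) • d`, whose squared norm involves only the Gram matrix. -/
lemma charFunDual_map_inner_pair_stdGaussian (c d : E) (L : StrongDual ℝ (ℝ × ℝ)) :
    charFunDual ((stdGaussian E).map (fun w => (⟪c, w⟫, ⟪d, w⟫))) L =
      Complex.exp (-(((L (1, 0)) ^ 2 * ⟪c, c⟫ + 2 * L (1, 0) * L (0, 1) * ⟪c, d⟫ +
        (L (0, 1)) ^ 2 * ⟪d, d⟫ : ℝ) : ℂ) / 2) := by
  have hL : ∀ w : E, L (⟪c, w⟫, ⟪d, w⟫) = ⟪w, L (1, 0) • c + L (0, 1) • d⟫ := fun w => by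
    have h : ((⟪c, w⟫, ⟪d, w⟫) : ℝ × ℝ) = ⟪c, w⟫ • (1, 0) + ⟪d, w⟫ • (0, 1) := by simp
    rw [h, map_add, map_smul, map_smul, inner_add_right, real_inner_smul_right,
      real_inner_smul_right, real_inner_comm w, real_inner_comm w]
    simp [mul_comm]
  rw [charFunDual_apply, integral_map (by fun_prop) (by fun_prop)]
  simp_rw [hL]
  rw [← charFun_apply, charFun_stdGaussian]
  congr 3
  norm_cast
  rw [← real_inner_self_eq_norm_sq]
  simp only [inner_add_left, inner_add_right, real_inner_smul_left, real_inner_smul_right,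
    real_inner_comm c d]
  ring

/-- Two inner products with a standard Gaussian vector have a joint law which only depends on
the Gram matrix. -/
lemma map_inner_pair_stdGaussian {a b : E} {p q : F} (haa : ⟪a, a⟫ = ⟪p, p⟫)
    (hab : ⟪a, b⟫ = ⟪p, q⟫) (hbb : ⟪b, b⟫ = ⟪q, q⟫) :
    (stdGaussian E).map (fun w => (⟪a, w⟫, ⟪b, w⟫)) =
      (stdGaussian F).map (fun w => (⟪p, w⟫, ⟪q, w⟫)) := by
  have : IsProbabilityMeasure ((stdGaussian E).map (fun w => (⟪a, w⟫, ⟪b, w⟫))) :=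
    Measure.isProbabilityMeasure_map (by fun_prop)
  have : IsProbabilityMeasure ((stdGaussian F).map (fun w => (⟪p, w⟫, ⟪q, w⟫))) :=
    Measure.isProbabilityMeasure_map (by fun_prop)
  apply Measure.ext_of_charFunDual
  ext L
  rw [charFunDual_map_inner_pair_stdGaussian, charFunDual_map_inner_pair_stdGaussian, haa, hab, hbb]

lemma map_inner_stdGaussian (a : E) :
    (stdGaussian E).map (fun w => ⟪a, w⟫) = gaussianReal 0 (‖a‖₊ ^ 2) := by
  have : IsProbabilityMeasure ((stdGaussian E).map (fun w => ⟪a, w⟫)) :=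
    Measure.isProbabilityMeasure_map (by fun_prop)
  apply Measure.ext_of_charFun
  ext t
  rw [charFun_gaussianReal, charFun_apply, integral_map (by fun_prop) (by fun_prop)]
  have h : ∀ w : E, ⟪⟪a, w⟫, t⟫ = ⟪w, t • a⟫ := fun w => by
    rw [real_inner_smul_right, real_inner_comm w]; simp
  simp_rw [h]
  rw [← charFun_apply, charFun_stdGaussian, norm_smul, ← Complex.ofReal_pow, mul_pow,
    Real.norm_eq_abs, sq_abs]
  simp
  ring_nf

lemma map_inner_stdGaussian' (a : E) :
    (stdGaussian E).map (fun w => ⟪a, w⟫) = (gaussianReal 0 1).map (fun x => ‖a‖ * x) := by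
  rw [map_inner_stdGaussian, gaussianReal_map_const_mul]
  congr 1
  · simp
  · ext; simp

lemma memLp_inner_stdGaussian (a : E) (p : ENNReal) (hp : p ≠ ⊤) :
    MemLp (fun w => ⟪a, w⟫) p (stdGaussian E) := by
  have h := memLp_id_gaussianReal' (μ := 0) (v := ‖a‖₊ ^ 2) p hp
  rw [← map_inner_stdGaussian] at h
  exact (memLp_map_measure_iff (f := fun w => ⟪a, w⟫) (by fun_prop) (by fun_prop)).1 h

lemma integral_inner_pow_two_stdGaussian (a : E) :
    ∫ w, ⟪a, w⟫ ^ 2 ∂stdGaussian E = ‖a‖ ^ 2 := by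
  have h : ∫ x, x ^ 2 ∂((stdGaussian E).map (fun w => ⟪a, w⟫)) = ‖a‖ ^ 2 := by
    rw [map_inner_stdGaussian', integral_map (by fun_prop) (by fun_prop)]
    simp_rw [mul_pow]
    rw [integral_const_mul, integral_pow_two_gaussianReal, mul_one]
  rwa [integral_map (by fun_prop) (by fun_prop)] at h

lemma integral_inner_pow_four_stdGaussian (a : E) :
    ∫ w, ⟪a, w⟫ ^ 4 ∂stdGaussian E = 3 * ‖a‖ ^ 4 := by
  have h : ∫ x, x ^ 4 ∂((stdGaussian E).map (fun w => ⟪a, w⟫)) = 3 * ‖a‖ ^ 4 := by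
    rw [map_inner_stdGaussian', integral_map (by fun_prop) (by fun_prop)]
    simp_rw [mul_pow]
    rw [integral_const_mul, integral_pow_four_gaussianReal, mul_comm]
  rwa [integral_map (by fun_prop) (by fun_prop)] at h

lemma integrable_inner_pow_stdGaussian (a : E) (k : ℕ) :
    Integrable (fun w => ⟪a, w⟫ ^ k) (stdGaussian E) := by
  rcases Nat.eq_zero_or_pos k with rfl | hk
  · simp
  · refine (integrable_norm_iff (by fun_prop)).1 ?_
    simpa using (memLp_inner_stdGaussian a k (by simp)).integrable_norm_pow hk.ne'

lemma integral_inner_mul_inner_stdGaussian (a b : E) :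
    ∫ w, ⟪a, w⟫ * ⟪b, w⟫ ∂stdGaussian E = ⟪a, b⟫ := by
  have h : ∀ w : E, ⟪a, w⟫ * ⟪b, w⟫ = (⟪a + b, w⟫ ^ 2 - ⟪a - b, w⟫ ^ 2) / 4 := fun w => by
    rw [inner_add_left, inner_sub_left]; ring
  simp_rw [h]
  rw [integral_div, integral_sub (integrable_inner_pow_stdGaussian _ _)
    (integrable_inner_pow_stdGaussian _ _), integral_inner_pow_two_stdGaussian,
    integral_inner_pow_two_stdGaussian, norm_add_sq_real, norm_sub_sq_real]
  ring

omit [FiniteDimensional ℝ E] [MeasurableSpace E] [BorelSpace E] in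
-- Polarization reduces mixed fourth moments to pure fourth powers; `192 = 4! · 2³` counts the
-- orderings of the factors and the sign choices.
lemma inner_mul_four_polarization (a b c d w : E) :
    ⟪a, w⟫ * ⟪b, w⟫ * ⟪c, w⟫ * ⟪d, w⟫ =
      (⟪a + b + c + d, w⟫ ^ 4 - ⟪a + b + c - d, w⟫ ^ 4 - ⟪a + b - c + d, w⟫ ^ 4
        + ⟪a + b - c - d, w⟫ ^ 4 - ⟪a - b + c + d, w⟫ ^ 4 + ⟪a - b + c - d, w⟫ ^ 4
        + ⟪a - b - c + d, w⟫ ^ 4 - ⟪a - b - c - d, w⟫ ^ 4) / 192 := by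
  simp only [inner_add_left, inner_sub_left]
  ring

lemma integrable_inner_mul_four_stdGaussian (a b c d : E) :
    Integrable (fun w => ⟪a, w⟫ * ⟪b, w⟫ * ⟪c, w⟫ * ⟪d, w⟫) (stdGaussian E) := by
  simp_rw [inner_mul_four_polarization]
  have := fun x : E => integrable_inner_pow_stdGaussian x 4
  exact ((((((((this _).sub (this _)).sub (this _)).add (this _)).sub (this _)).add
    (this _)).add (this _)).sub (this _)).div_const _

/-- Isserlis' formula for the fourth moments of a standard Gaussian vector. -/
lemma integral_inner_mul_four_stdGaussian (a b c d : E) :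
    ∫ w, ⟪a, w⟫ * ⟪b, w⟫ * ⟪c, w⟫ * ⟪d, w⟫ ∂stdGaussian E =
      ⟪a, b⟫ * ⟪c, d⟫ + ⟪a, c⟫ * ⟪b, d⟫ + ⟪a, d⟫ * ⟪b, c⟫ := by
  simp_rw [inner_mul_four_polarization]
  have hI := fun x : E => integrable_inner_pow_stdGaussian x 4
  have h4 : ∀ x : E, ‖x‖ ^ 4 = ⟪x, x⟫ ^ 2 := fun x => by
    rw [real_inner_self_eq_norm_sq]; ring
  rw [integral_div, integral_sub, integral_add, integral_add, integral_sub, integral_add,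
    integral_sub, integral_sub]
  any_goals fun_prop
  simp only [integral_inner_pow_four_stdGaussian, h4]
  simp only [inner_add_left, inner_sub_left, inner_add_right, inner_sub_right]
  rw [real_inner_comm a b, real_inner_comm a c, real_inner_comm a d, real_inner_comm b c,
    real_inner_comm b d, real_inner_comm c d]
  ring

lemma ae_inner_ne_zero_stdGaussian {a : E} (ha : a ≠ 0) :
    ∀ᵐ w ∂stdGaussian E, ⟪a, w⟫ ≠ 0 := by
  have : NullSingletonClass (gaussianReal 0 (‖a‖₊ ^ 2)) :=
    nullSingletonClass_gaussianReal (by simpa using ha)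
  have h : ∀ᵐ x ∂gaussianReal 0 (‖a‖₊ ^ 2), x ≠ 0 := by
    rw [ae_iff]; simp
  rw [← map_inner_stdGaussian] at h
  exact ae_of_ae_map (f := fun w => ⟪a, w⟫) (by fun_prop) h

end GaussianMoments

/-! ### Reduction to the plane: the ReLU kernel and the joint activation probability. -/

section PlanarGaussian

/-- The derivative of `relu`, taken to be `0` at the kink. -/
noncomputable def reluDeriv (t : ℝ) : ℝ := if 0 < t then 1 else 0

lemma measurable_reluDeriv : Measurable reluDeriv :=
  Measurable.ite measurableSet_Ioi measurable_const measurable_const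

lemma continuous_relu : Continuous relu := continuous_const.max continuous_id

lemma reluDeriv_nonneg (t : ℝ) : 0 ≤ reluDeriv t := by unfold reluDeriv; split_ifs <;> simp

lemma reluDeriv_le_one (t : ℝ) : reluDeriv t ≤ 1 := by unfold reluDeriv; split_ifs <;> simp

lemma relu_nonneg (t : ℝ) : 0 ≤ relu t := le_max_left _ _

lemma relu_le_abs (t : ℝ) : relu t ≤ |t| := max_le (abs_nonneg t) (le_abs_self t)

lemma relu_mul_of_nonneg {c : ℝ} (hc : 0 ≤ c) (t : ℝ) : relu (c * t) = c * relu t := by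
  simp [relu, mul_max_of_nonneg _ _ hc]

lemma reluDeriv_mul_of_pos {c : ℝ} (hc : 0 < c) (t : ℝ) : reluDeriv (c * t) = reluDeriv t := by
  simp [reluDeriv, hc]

/-- The law of a pair of independent standard Gaussian variables. -/
noncomputable def planarGaussian : Measure (ℝ × ℝ) := (gaussianReal 0 1).prod (gaussianReal 0 1)

instance : IsProbabilityMeasure planarGaussian := by unfold planarGaussian; infer_instance

variable {E : Type*} [NormedAddCommGroup E] [InnerProductSpace ℝ E] [FiniteDimensional ℝ E]
  [MeasurableSpace E] [BorelSpace E]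


lemma map_stdGaussian_fin_two :
    (stdGaussian (EuclideanSpace ℝ (Fin 2))).map (fun w => (w 0, w 1)) = planarGaussian := by
  rw [← map_pi_eq_stdGaussian, Measure.map_map (by fun_prop) (by fun_prop)]
  exact (measurePreserving_finTwoArrow (gaussianReal 0 1)).map_eq

/-- The planar vectors `‖a‖ (1, 0)` and `‖b‖ (cos θ, sin θ)` have the same Gram matrix as `a` and
`b`. -/
lemma map_inner_pair_eq_planarGaussian (a b : E) :
    (stdGaussian E).map (fun w => (⟪a, w⟫, ⟪b, w⟫)) = planarGaussian.map (fun u =>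
      (‖a‖ * u.1, ‖b‖ * (Real.cos (InnerProductGeometry.angle a b) * u.1 +
        Real.sin (InnerProductGeometry.angle a b) * u.2))) := by
  set θ := InnerProductGeometry.angle a b with hθ
  have hs := Real.sin_sq_add_cos_sq θ
  have hab := InnerProductGeometry.cos_angle_mul_norm_mul_norm a b
  rw [map_inner_pair_stdGaussian (p := !₂[‖a‖, 0])
    (q := !₂[‖b‖ * Real.cos θ, ‖b‖ * Real.sin θ]), ← map_stdGaussian_fin_two,
    Measure.map_map (by fun_prop) (by fun_prop)]
  · congr 1
    ext w <;> simp [Fin.sum_univ_two, PiLp.inner_apply] <;> ring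
  · rw [real_inner_self_eq_norm_sq, real_inner_self_eq_norm_sq,
      EuclideanSpace.real_norm_sq_eq]
    simp
  · simp [PiLp.inner_apply, ← hab]
    ring
  · rw [real_inner_self_eq_norm_sq, real_inner_self_eq_norm_sq,
      EuclideanSpace.real_norm_sq_eq]
    simp only [Fin.sum_univ_two, Matrix.cons_val_zero, Matrix.cons_val_one]
    linear_combination (-‖b‖ ^ 2) * hs

lemma planarGaussian_eq_withDensity :
    planarGaussian = (volume : Measure (ℝ × ℝ)).withDensity (fun u => ENNReal.ofReal
      ((2 * Real.pi)⁻¹ * Real.exp (-(u.1 ^ 2 + u.2 ^ 2) / 2))) := by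
  unfold planarGaussian
  rw [gaussianReal_of_var_ne_zero _ one_ne_zero, prod_withDensity (by fun_prop) (by fun_prop),
    ← Measure.volume_eq_prod]
  congr 1
  ext u
  rw [gaussianPDF, gaussianPDF, ← ENNReal.ofReal_mul (gaussianPDFReal_nonneg _ _ _)]
  congr 1
  simp only [gaussianPDFReal, NNReal.coe_one, sub_zero, mul_one]
  rw [mul_mul_mul_comm, ← mul_inv, Real.mul_self_sqrt (by positivity), ← Real.exp_add]
  congr 2
  ring


lemma lintegral_mul_exp_neg_sq_div_two :
    ∫⁻ r in Set.Ioi (0 : ℝ), ENNReal.ofReal r *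
      ENNReal.ofReal ((2 * Real.pi)⁻¹ * Real.exp (-r ^ 2 / 2)) =
      ENNReal.ofReal (2 * Real.pi)⁻¹ := by
  have hd : ∀ r : ℝ, HasDerivAt (fun r : ℝ => -((2 * Real.pi)⁻¹ * Real.exp (-r ^ 2 / 2)))
      (r * ((2 * Real.pi)⁻¹ * Real.exp (-r ^ 2 / 2))) r := fun r => by
    refine ((((((hasDerivAt_id r).pow 2).neg.div_const 2).exp).const_mul
      (2 * Real.pi)⁻¹).neg).congr_deriv ?_
    simp; ring
  have hlim : Tendsto (fun r : ℝ => -((2 * Real.pi)⁻¹ * Real.exp (-r ^ 2 / 2))) atTop (𝓝 0) := by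
    have h : Tendsto (fun r : ℝ => -r ^ 2 / 2) atTop atBot := by
      simp_rw [neg_div]
      exact tendsto_neg_atTop_atBot.comp
        ((tendsto_pow_atTop two_ne_zero).atTop_div_const (by norm_num))
    simpa using ((Real.tendsto_exp_atBot.comp h).const_mul (2 * Real.pi)⁻¹).neg
  have hpos : ∀ r ∈ Set.Ioi (0 : ℝ), 0 ≤ r * ((2 * Real.pi)⁻¹ * Real.exp (-r ^ 2 / 2)) :=
    fun r hr => mul_nonneg (le_of_lt hr) (by positivity)
  have hint := integrableOn_Ioi_deriv_of_nonneg' (fun r _ => hd r) hpos hlim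
  have hval := integral_Ioi_of_hasDerivAt_of_nonneg' (fun r _ => hd r) hpos hlim
  have h1 : ∫⁻ r in Set.Ioi (0 : ℝ), ENNReal.ofReal r *
      ENNReal.ofReal ((2 * Real.pi)⁻¹ * Real.exp (-r ^ 2 / 2)) =
      ∫⁻ r in Set.Ioi (0 : ℝ),
        ENNReal.ofReal (r * ((2 * Real.pi)⁻¹ * Real.exp (-r ^ 2 / 2))) :=
    setLIntegral_congr_fun measurableSet_Ioi fun r hr => (ENNReal.ofReal_mul (le_of_lt hr)).symm
  rw [h1, ← ofReal_integral_eq_lintegral_ofReal hint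
    ((ae_restrict_iff' measurableSet_Ioi).2 (ae_of_all _ hpos)), hval]
  simp

/-- This is the set of polar angles at which both variables are positive, an arc of length `π - θ`.
-/
lemma setOf_cos_pos_and_cos_sub_pos {θ : ℝ} (h0 : 0 ≤ θ) (hpi : θ ≤ Real.pi) :
    {t | t ∈ Set.Ioo (-Real.pi) Real.pi ∧ 0 < Real.cos t ∧ 0 < Real.cos (t - θ)} =
      Set.Ioo (θ - Real.pi / 2) (Real.pi / 2) := by
  have hp := Real.pi_pos
  ext t
  simp only [Set.mem_ofPred_eq, Set.mem_Ioo]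
  constructor
  · rintro ⟨⟨h1, h2⟩, h3, h4⟩
    have h5 : t < Real.pi / 2 := by
      by_contra! h
      exact absurd (Real.cos_nonpos_of_pi_div_two_le_of_le h (by linarith)) (not_le.2 h3)
    have h6 : -(Real.pi / 2) < t := by
      by_contra! h
      have := Real.cos_nonpos_of_pi_div_two_le_of_le (x := -t) (by linarith) (by linarith)
      rw [Real.cos_neg] at this
      linarith
    refine ⟨?_, h5⟩
    by_contra! h
    have := Real.cos_nonpos_of_pi_div_two_le_of_le (x := -(t - θ)) (by linarith) (by linarith)
    rw [Real.cos_neg] at this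
    linarith
  · rintro ⟨h1, h2⟩
    exact ⟨⟨by linarith, by linarith⟩, Real.cos_pos_of_mem_Ioo ⟨by linarith, by linarith⟩,
      Real.cos_pos_of_mem_Ioo ⟨by linarith, by linarith⟩⟩

lemma measurableSet_quadrant (θ : ℝ) : MeasurableSet
    {u : ℝ × ℝ | 0 < u.1 ∧ 0 < Real.cos θ * u.1 + Real.sin θ * u.2} :=
  ((isOpen_lt continuous_const continuous_fst).inter
    (isOpen_lt (f := fun _ : ℝ × ℝ => (0 : ℝ)) continuous_const (by fun_prop))).measurableSet

/-- The probability that two standard Gaussian variables at angle `θ` are both positive. -/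
lemma planarGaussian_quadrant {θ : ℝ} (h0 : 0 ≤ θ) (hpi : θ ≤ Real.pi) :
    planarGaussian {u | 0 < u.1 ∧ 0 < Real.cos θ * u.1 + Real.sin θ * u.2} =
      ENNReal.ofReal ((Real.pi - θ) / (2 * Real.pi)) := by
  set S : Set (ℝ × ℝ) := {u | 0 < u.1 ∧ 0 < Real.cos θ * u.1 + Real.sin θ * u.2}
  have hS : MeasurableSet S := measurableSet_quadrant θ
  rw [planarGaussian_eq_withDensity, withDensity_apply _ hS, ← lintegral_indicator hS,
    ← lintegral_comp_polarCoord_symm, polarCoord_target]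
  set A : Set ℝ := {t | t ∈ Set.Ioo (-Real.pi) Real.pi ∧ 0 < Real.cos t ∧ 0 < Real.cos (t - θ)}
    with hA
  have hAm : MeasurableSet A := by
    rw [hA, setOf_cos_pos_and_cos_sub_pos h0 hpi]; exact measurableSet_Ioo
  -- By rotation invariance of the density and scale invariance of `S`, the integrand splits into a
  -- radial factor and the indicator of the arc.
  have key : ∀ p ∈ Set.Ioi (0 : ℝ) ×ˢ Set.Ioo (-Real.pi) Real.pi,
      ENNReal.ofReal p.1 • S.indicator (fun u => ENNReal.ofReal
        ((2 * Real.pi)⁻¹ * Real.exp (-(u.1 ^ 2 + u.2 ^ 2) / 2))) (polarCoord.symm p) =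
      (ENNReal.ofReal p.1 * ENNReal.ofReal ((2 * Real.pi)⁻¹ * Real.exp (-p.1 ^ 2 / 2))) *
        A.indicator 1 p.2 := by
    rintro ⟨r, t⟩ ⟨hr, ht⟩
    simp only [Set.mem_Ioi] at hr
    simp only at ht
    have hmem : polarCoord.symm (r, t) ∈ S ↔ t ∈ A := by
      have h2 : Real.cos θ * (r * Real.cos t) + Real.sin θ * (r * Real.sin t) =
          r * Real.cos (t - θ) := by rw [Real.cos_sub]; ring
      simp [S, A, polarCoord_symm_apply, h2, hr, ht.1, ht.2]
    by_cases h : t ∈ A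
    · rw [Set.indicator_of_mem (hmem.2 h), Set.indicator_of_mem h]
      have h3 : (r * Real.cos t) ^ 2 + (r * Real.sin t) ^ 2 = r ^ 2 := by
        linear_combination r ^ 2 * Real.sin_sq_add_cos_sq t
      simp [polarCoord_symm_apply, h3]
    · rw [Set.indicator_of_notMem (fun h' => h (hmem.1 h')), Set.indicator_of_notMem h]
      simp
  rw [setLIntegral_congr_fun (measurableSet_Ioi.prod measurableSet_Ioo) key,
    Measure.volume_eq_prod, ← Measure.prod_restrict,
    lintegral_prod_mul (f := fun r : ℝ => ENNReal.ofReal r *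
      ENNReal.ofReal ((2 * Real.pi)⁻¹ * Real.exp (-r ^ 2 / 2))) (g := A.indicator 1)
      (by fun_prop) (measurable_one.indicator hAm).aemeasurable,
    lintegral_mul_exp_neg_sq_div_two, lintegral_indicator_one hAm,
    Measure.restrict_apply hAm, Set.inter_eq_left.2 fun t ht => ht.1, hA,
    setOf_cos_pos_and_cos_sub_pos h0 hpi, Real.volume_Ioo, ← ENNReal.ofReal_mul (by positivity)]
  congr 1
  field_simp
  ring

/-- The correlation of two rectified standard Gaussian variables at angle `θ`. -/
noncomputable def reluKernel (θ : ℝ) : ℝ :=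
  ∫ u, relu u.1 * relu (Real.cos θ * u.1 + Real.sin θ * u.2) ∂planarGaussian

lemma integrable_planarGaussian_sq : Integrable (fun u : ℝ × ℝ => u.1 ^ 2) planarGaussian ∧
    Integrable (fun u : ℝ × ℝ => u.2 ^ 2) planarGaussian := by
  have h : Integrable (fun x : ℝ => x ^ 2) (gaussianReal 0 1) :=
    (memLp_id_gaussianReal 2).integrable_sq
  exact ⟨h.comp_fst _, h.comp_snd _⟩

/-- Dominated convergence with a quadratic bound independent of `θ`. Continuity carries the
convergence of the angles from one layer to the next. -/
lemma continuous_reluKernel : Continuous reluKernel := by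
  unfold reluKernel
  have hr := continuous_relu
  refine continuous_of_dominated (bound := fun u => 2 * (u.1 ^ 2 + u.2 ^ 2)) ?_ ?_ ?_ ?_
  · intro θ
    exact (by fun_prop : Continuous fun u : ℝ × ℝ =>
      relu u.1 * relu (Real.cos θ * u.1 + Real.sin θ * u.2)).aestronglyMeasurable
  · intro θ
    refine ae_of_all _ fun u => ?_
    rw [Real.norm_eq_abs, abs_mul, abs_of_nonneg (relu_nonneg _), abs_of_nonneg (relu_nonneg _)]
    have h1 := relu_le_abs u.1
    have h2 := relu_le_abs (Real.cos θ * u.1 + Real.sin θ * u.2)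
    have h3 : |Real.cos θ * u.1 + Real.sin θ * u.2| ≤ |u.1| + |u.2| := by
      refine (abs_add_le _ _).trans ?_
      rw [abs_mul, abs_mul]
      gcongr
      · exact mul_le_of_le_one_left (abs_nonneg _) (Real.abs_cos_le_one _)
      · exact mul_le_of_le_one_left (abs_nonneg _) (Real.abs_sin_le_one _)
    have h4 : relu u.1 * relu (Real.cos θ * u.1 + Real.sin θ * u.2) ≤
        |u.1| * (|u.1| + |u.2|) :=
      mul_le_mul h1 (h2.trans h3) (relu_nonneg _) (abs_nonneg _)
    refine h4.trans ?_
    nlinarith [sq_nonneg (|u.1| - |u.2|), sq_abs u.1, sq_abs u.2, sq_nonneg u.1, sq_nonneg u.2]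
  · exact ((integrable_planarGaussian_sq.1.add integrable_planarGaussian_sq.2).const_mul 2)
  · exact ae_of_all _ fun u => by fun_prop

/-- `relu x ^ 2 + relu (-x) ^ 2 = x ^ 2`, and the two terms have equal Gaussian integrals by
symmetry. This is why the factor `√2` in the network preserves norms in the limit. -/
lemma two_mul_reluKernel_zero : 2 * reluKernel 0 = 1 := by
  have hr := continuous_relu
  have h1 : reluKernel 0 = ∫ x, relu x ^ 2 ∂gaussianReal 0 1 := by
    unfold reluKernel planarGaussian
    simp only [Real.cos_zero, Real.sin_zero, one_mul, zero_mul, add_zero, ← sq]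
    exact (integral_fun_fst (fun x => relu x ^ 2)).trans (by simp)
  have hint : ∀ f : ℝ → ℝ, Continuous f → (∀ x, |f x| ≤ x ^ 2) →
      Integrable f (gaussianReal 0 1) := fun f hf hb =>
    ((memLp_id_gaussianReal (μ := 0) (v := 1) 2).integrable_sq).mono'
      hf.aestronglyMeasurable (ae_of_all _ fun x => by simpa using hb x)
  have hb : ∀ x, relu x ^ 2 ≤ x ^ 2 := fun x => by
    rw [← sq_abs x]
    exact pow_le_pow_left₀ (relu_nonneg x) (relu_le_abs x) 2
  have h2 : ∫ x, relu x ^ 2 ∂gaussianReal 0 1 = ∫ x, relu (-x) ^ 2 ∂gaussianReal 0 1 := by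
    conv_lhs => rw [← neg_zero, ← gaussianReal_map_neg]
    rw [integral_map (by fun_prop) (by fun_prop)]
  have h3 : ∫ x, relu x ^ 2 ∂gaussianReal 0 1 + ∫ x, relu (-x) ^ 2 ∂gaussianReal 0 1 = 1 := by
    rw [← integral_add, ← integral_pow_two_gaussianReal]
    · congr 1
      ext x
      rcases le_total 0 x with hx | hx <;> simp [relu, hx]
    · exact hint _ (by fun_prop) fun x => by rw [abs_of_nonneg (by positivity)]; exact hb x
    · refine hint _ (by fun_prop) fun x => ?_
      rw [abs_of_nonneg (by positivity)]
      simpa using hb (-x)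
  rw [h1]
  linarith

lemma integral_relu_mul_relu_stdGaussian (a b : E) :
    ∫ w, relu ⟪a, w⟫ * relu ⟪b, w⟫ ∂stdGaussian E =
      ‖a‖ * ‖b‖ * reluKernel (InnerProductGeometry.angle a b) := by
  have hr := continuous_relu
  have h : ∫ u, relu u.1 * relu u.2 ∂((stdGaussian E).map (fun w => (⟪a, w⟫, ⟪b, w⟫))) =
      ‖a‖ * ‖b‖ * reluKernel (InnerProductGeometry.angle a b) := by
    rw [map_inner_pair_eq_planarGaussian, integral_map (by fun_prop)
      (by fun_prop : Continuous _).aestronglyMeasurable, reluKernel, ← integral_const_mul]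
    congr 1
    ext u
    simp only
    rw [relu_mul_of_nonneg (norm_nonneg _), relu_mul_of_nonneg (norm_nonneg _)]
    ring
  rwa [integral_map (by fun_prop) (by fun_prop : Continuous _).aestronglyMeasurable] at h

/-- The integral is the probability of the quadrant event. Zero vectors must be excluded: there
`reluDeriv 0 = 0` makes the left side `0`, whereas the conventional angle `π / 2` makes the right
side `1 / 2`. -/
lemma integral_reluDeriv_mul_reluDeriv_stdGaussian {a b : E} (ha : a ≠ 0) (hb : b ≠ 0) :
    2 * ∫ w, reluDeriv ⟪a, w⟫ * reluDeriv ⟪b, w⟫ ∂stdGaussian E =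
      1 - InnerProductGeometry.angle a b / Real.pi := by
  set θ := InnerProductGeometry.angle a b with hθ
  have hr := measurable_reluDeriv
  have hm : Measurable fun u : ℝ × ℝ => reluDeriv u.1 * reluDeriv u.2 :=
    (hr.comp measurable_fst).mul (hr.comp measurable_snd)
  have h : ∫ u, reluDeriv u.1 * reluDeriv u.2
      ∂((stdGaussian E).map (fun w => (⟪a, w⟫, ⟪b, w⟫))) = (Real.pi - θ) / (2 * Real.pi) := by
    rw [map_inner_pair_eq_planarGaussian, integral_map (by fun_prop) hm.aestronglyMeasurable]
    have h1 : ∀ u : ℝ × ℝ, reluDeriv (‖a‖ * u.1) * reluDeriv (‖b‖ * (Real.cos θ * u.1 +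
        Real.sin θ * u.2)) =
        ({u | 0 < u.1 ∧ 0 < Real.cos θ * u.1 + Real.sin θ * u.2} : Set (ℝ × ℝ)).indicator
          1 u := fun u => by
      rw [reluDeriv_mul_of_pos (norm_pos_iff.2 ha), reluDeriv_mul_of_pos (norm_pos_iff.2 hb)]
      simp only [reluDeriv, Set.indicator_apply, Set.mem_ofPred_eq, Pi.one_apply, ite_and]
      split_ifs <;> simp
    simp only [← hθ]
    simp_rw [h1]
    rw [integral_indicator_one (measurableSet_quadrant θ), measureReal_def,
      planarGaussian_quadrant (InnerProductGeometry.angle_nonneg _ _)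
        (InnerProductGeometry.angle_le_pi _ _), ENNReal.toReal_ofReal]
    exact div_nonneg (sub_nonneg.2 (InnerProductGeometry.angle_le_pi _ _)) (by positivity)
  rw [integral_map (by fun_prop) hm.aestronglyMeasurable] at h
  rw [h]
  field_simp

end PlanarGaussian

/-! ### Independent rows and the mean-square law of large numbers. -/

section GaussianRows

variable {ι κ η : Type*} [Fintype ι] [Fintype κ] [Fintype η]

lemma map_pi_comp_injective {α : Type*} [MeasurableSpace α] (ν : Measure α)
    [IsProbabilityMeasure ν] {e : κ → ι} (he : Function.Injective e) :
    (Measure.pi fun _ : ι => ν).map (fun v k => v (e k)) = Measure.pi fun _ : κ => ν := by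
  have h : iIndepFun (fun (i : ι) (v : ι → α) => v i) (Measure.pi fun _ : ι => ν) :=
    iIndepFun_pi (X := fun _ => id) fun _ => aemeasurable_id
  have h2 := h.precomp he
  rw [iIndepFun_iff_map_fun_eq_pi_map (fun k => (measurable_pi_apply (e k)).aemeasurable)] at h2
  rw [h2]
  congr 1
  ext1 k
  exact (measurePreserving_eval (fun _ : ι => ν) (e k)).map_eq

lemma map_pi_curry {α : Type*} [MeasurableSpace α] (ν : Measure α) [IsProbabilityMeasure ν] :
    (Measure.pi fun _ : κ × η => ν).map (fun v k j => v (k, j)) =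
      Measure.pi fun _ : κ => Measure.pi fun _ : η => ν := by
  have h := Measure.infinitePi_map_curry (ι := κ) (κ := η) (fun _ _ => ν)
  simp only [Measure.infinitePi_eq_pi] at h
  exact h

/-- Disjoint blocks of coordinates of a standard Gaussian vector are independent standard
Gaussian vectors. -/
lemma map_rows_stdGaussian {e : κ → η → ι} (he : Function.Injective (Function.uncurry e)) :
    (stdGaussian (EuclideanSpace ℝ ι)).map
      (fun w k => (WithLp.toLp 2 fun j => w (e k j) : EuclideanSpace ℝ η)) =
      Measure.pi fun _ : κ => stdGaussian (EuclideanSpace ℝ η) := by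
  simp_rw [← map_pi_eq_stdGaussian]
  rw [← Measure.pi_map_pi (fun _ => by fun_prop), ← map_pi_curry,
    ← map_pi_comp_injective (gaussianReal 0 1) he, Measure.map_map, Measure.map_map,
    Measure.map_map]
  · rfl
  all_goals fun_prop

/-- The empirical mean over independent blocks of a standard Gaussian vector is close to the
expectation in mean square. -/
lemma integral_rows_average_sub_sq_le {m : ℕ} {e : κ → η → ι}
    (he : Function.Injective (Function.uncurry e)) (hκ : Fintype.card κ = m)
    (hm : 0 < m) {f : EuclideanSpace ℝ η → ℝ}
    (hfm : Measurable f) (hf : MemLp f 2 (stdGaussian (EuclideanSpace ℝ η))) :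
    Integrable (fun w : EuclideanSpace ℝ ι => ((m : ℝ)⁻¹ * ∑ k, f (WithLp.toLp 2 fun j => w (e k j))
      - ∫ u, f u ∂stdGaussian (EuclideanSpace ℝ η)) ^ 2) (stdGaussian (EuclideanSpace ℝ ι)) ∧
    ∫ w : EuclideanSpace ℝ ι, ((m : ℝ)⁻¹ * ∑ k, f (WithLp.toLp 2 fun j => w (e k j))
      - ∫ u, f u ∂stdGaussian (EuclideanSpace ℝ η)) ^ 2 ∂stdGaussian (EuclideanSpace ℝ ι) ≤
      (∫ u, f u ^ 2 ∂stdGaussian (EuclideanSpace ℝ η)) / m := by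
  set ν := stdGaussian (EuclideanSpace ℝ η)
  set R : EuclideanSpace ℝ ι → κ → EuclideanSpace ℝ η :=
    fun w k => WithLp.toLp 2 fun j => w (e k j)
  have hR : Measurable R := by fun_prop
  have hm' : (m : ℝ) ≠ 0 := by positivity
  set S : (κ → EuclideanSpace ℝ η) → ℝ := ∑ k, fun V => f (V k) with hS
  have hSm : MemLp S 2 (Measure.pi fun _ : κ => ν) := by
    rw [hS]
    exact memLp_finsetSum' _ fun k _ =>
      hf.comp_measurePreserving (measurePreserving_eval (fun _ : κ => ν) k)
  have hSmeas : Measurable S := by rw [hS]; fun_prop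
  set X : (κ → EuclideanSpace ℝ η) → ℝ := fun V => (m : ℝ)⁻¹ * S V with hX
  have hXL : MemLp X 2 (Measure.pi fun _ : κ => ν) := hSm.const_mul _
  have hmean : ∫ V, X V ∂(Measure.pi fun _ : κ => ν) = ∫ u, f u ∂ν := by
    rw [hX, integral_const_mul, hS]
    simp only [Finset.sum_apply]
    rw [integral_finsetSum (f := fun k (V : κ → EuclideanSpace ℝ η) => f (V k)) _
      fun k _ => ((hf.comp_measurePreserving
      (measurePreserving_eval (fun _ : κ => ν) k)).integrable one_le_two)]
    have h1 : ∀ k : κ, ∫ V : κ → EuclideanSpace ℝ η, f (V k)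
        ∂(Measure.pi fun _ : κ => ν) = ∫ u, f u ∂ν := fun k => by
      have h2 := integral_map (μ := Measure.pi fun _ : κ => ν) (φ := fun V => V k) (f := f)
        (measurable_pi_apply k).aemeasurable (by fun_prop)
      rw [← h2]
      exact congrArg (fun μ => ∫ u, f u ∂μ) (measurePreserving_eval (fun _ : κ => ν) k).map_eq
    simp [h1, hκ, hm']
  -- Variances of independent summands add, so the mean has variance `Var[f] / m`; the second moment
  -- is a convenient upper bound for `Var[f]`.
  have hvar : Var[X; Measure.pi fun _ : κ => ν] ≤ (∫ u, f u ^ 2 ∂ν) / m := by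
    rw [hX, variance_const_mul, hS, variance_sum_pi (fun _ => hf)]
    have h2 : Var[f; ν] ≤ ∫ u, f u ^ 2 ∂ν := variance_le_expectation_sq hf.1
    simp only [Finset.sum_const, Finset.card_univ, hκ, nsmul_eq_mul]
    have h3 : (m : ℝ)⁻¹ ^ 2 * (m * Var[f; ν]) = Var[f; ν] / m := by field_simp
    rw [h3]
    gcongr
  have hint : Integrable (fun V => (X V - ∫ u, f u ∂ν) ^ 2) (Measure.pi fun _ : κ => ν) :=
    (hXL.sub (memLp_const _)).integrable_sq
  have hval : ∫ V, (X V - ∫ u, f u ∂ν) ^ 2 ∂(Measure.pi fun _ : κ => ν) =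
      Var[X; Measure.pi fun _ : κ => ν] := by
    rw [variance_eq_integral (by fun_prop), hmean]
  have hXm : Measurable X := by fun_prop
  have heq : ∀ w, (X (R w) - ∫ u, f u ∂ν) ^ 2 =
      ((m : ℝ)⁻¹ * ∑ k, f (WithLp.toLp 2 fun j => w (e k j)) - ∫ u, f u ∂ν) ^ 2 := fun w => by
    simp [hX, hS, R]
  rw [← map_rows_stdGaussian he] at hint hval
  constructor
  · have := hint.comp_measurable hR
    refine this.congr (ae_of_all _ fun w => heq w)
  · rw [integral_map hR.aemeasurable (by fun_prop)] at hval
    simp_rw [heq] at hval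
    rw [hval, map_rows_stdGaussian he]
    exact hvar

end GaussianRows

/-! ### Concentration of Gaussian quadratic forms around the trace. -/

section QuadraticForms

variable {ι η κ : Type*} [Fintype η]

/-- The value `W_k Θ W_k'` where the rows `W_k`, `W_k'` are read off from the vector `w`. -/
def rowForm (e : κ → η → ι) (Θ : η → η → ℝ) (k k' : κ) (w : EuclideanSpace ℝ ι) : ℝ :=
  ∑ p, ∑ q, w (e k p) * Θ p q * w (e k' q)

lemma rowForm_eq_sum (e : κ → η → ι) (Θ : η → η → ℝ) (k k' : κ) (w : EuclideanSpace ℝ ι) :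
    rowForm e Θ k k' w = ∑ p, ∑ q, Θ p q * (w (e k p) * w (e k' q)) :=
  Finset.sum_congr rfl fun p _ => Finset.sum_congr rfl fun q _ => by ring

lemma rowForm_sq (e : κ → η → ι) (Θ : η → η → ℝ) (k k' : κ) (w : EuclideanSpace ℝ ι) :
    rowForm e Θ k k' w ^ 2 = ∑ x : η × η × η × η, (Θ x.1 x.2.1 * Θ x.2.2.1 x.2.2.2) *
      (w (e k x.1) * w (e k' x.2.1) * w (e k x.2.2.1) * w (e k' x.2.2.2)) := by
  simp only [Fintype.sum_prod_type]
  rw [rowForm, sq, Finset.sum_mul]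
  refine Finset.sum_congr rfl fun p _ => ?_
  rw [Finset.sum_mul]
  refine Finset.sum_congr rfl fun q _ => ?_
  rw [Finset.mul_sum]
  refine Finset.sum_congr rfl fun r _ => ?_
  rw [Finset.mul_sum]
  refine Finset.sum_congr rfl fun s _ => ?_
  ring

/-- Isserlis' formula produces the pairing of `Θ` with its transpose, and the kernel of two
different inputs need not be symmetric. The inequality of arithmetic and geometric means compares it
with the Frobenius norm. -/
lemma sum_sum_mul_swap_le (Θ : η → η → ℝ) :
    ∑ p, ∑ q, Θ p q * Θ q p ≤ ∑ p, ∑ q, Θ p q ^ 2 := by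
  have h1 : ∑ p, ∑ q, Θ q p ^ 2 = ∑ p, ∑ q, Θ p q ^ 2 := Finset.sum_comm
  have h2 : ∑ p, ∑ q, Θ p q * Θ q p ≤ ∑ p, ∑ q, (Θ p q ^ 2 + Θ q p ^ 2) / 2 :=
    Finset.sum_le_sum fun p _ => Finset.sum_le_sum fun q _ => by
      nlinarith [sq_nonneg (Θ p q - Θ q p)]
  have h3 : ∑ p, ∑ q, (Θ p q ^ 2 + Θ q p ^ 2) / 2 =
      ((∑ p, ∑ q, Θ p q ^ 2) + ∑ p, ∑ q, Θ q p ^ 2) / 2 := by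
    simp_rw [← Finset.sum_div, Finset.sum_add_distrib]
  rw [h3, h1] at h2
  linarith

variable [Fintype ι]

lemma integrable_coord_mul_four (i j k l : ι) :
    Integrable (fun w : EuclideanSpace ℝ ι => w i * w j * w k * w l)
      (stdGaussian (EuclideanSpace ℝ ι)) := by
  classical
  simpa [EuclideanSpace.inner_single_left] using integrable_inner_mul_four_stdGaussian
    (EuclideanSpace.single i (1 : ℝ)) (EuclideanSpace.single j 1) (EuclideanSpace.single k 1)
    (EuclideanSpace.single l 1)

lemma integral_coord_mul_four [DecidableEq ι] (i j k l : ι) :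
    ∫ w : EuclideanSpace ℝ ι, w i * w j * w k * w l ∂stdGaussian (EuclideanSpace ℝ ι) =
      (if i = j then 1 else 0) * (if k = l then 1 else 0) +
      (if i = k then 1 else 0) * (if j = l then 1 else 0) +
      (if i = l then 1 else 0) * (if j = k then 1 else 0) := by
  have h := integral_inner_mul_four_stdGaussian
    (EuclideanSpace.single i (1 : ℝ)) (EuclideanSpace.single j 1) (EuclideanSpace.single k 1)
    (EuclideanSpace.single l 1)
  simpa [EuclideanSpace.inner_single_left, PiLp.single_apply] using h

lemma integrable_coord_mul (i j : ι) :
    Integrable (fun w : EuclideanSpace ℝ ι => w i * w j) (stdGaussian (EuclideanSpace ℝ ι)) := by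
  classical
  have h := (memLp_inner_stdGaussian (EuclideanSpace.single i (1 : ℝ)) 2 (by simp)).integrable_mul
    (memLp_inner_stdGaussian (EuclideanSpace.single j (1 : ℝ)) 2 (by simp))
  simpa [EuclideanSpace.inner_single_left, Pi.mul_def] using h

lemma integral_coord_mul [DecidableEq ι] (i j : ι) :
    ∫ w : EuclideanSpace ℝ ι, w i * w j ∂stdGaussian (EuclideanSpace ℝ ι) =
      if i = j then 1 else 0 := by
  have h := integral_inner_mul_inner_stdGaussian
    (EuclideanSpace.single i (1 : ℝ)) (EuclideanSpace.single j 1)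
  simpa [EuclideanSpace.inner_single_left, PiLp.single_apply] using h

lemma integrable_rowForm_sq (e : κ → η → ι) (Θ : η → η → ℝ) (k k' : κ) :
    Integrable (fun w => rowForm e Θ k k' w ^ 2) (stdGaussian (EuclideanSpace ℝ ι)) := by
  simp_rw [rowForm_sq]
  exact integrable_finsetSum _ fun x _ => (integrable_coord_mul_four _ _ _ _).const_mul _

lemma integrable_rowForm (e : κ → η → ι) (Θ : η → η → ℝ) (k k' : κ) :
    Integrable (fun w => rowForm e Θ k k' w) (stdGaussian (EuclideanSpace ℝ ι)) := by
  simp_rw [rowForm_eq_sum]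
  exact integrable_finsetSum _ fun p _ => integrable_finsetSum _ fun q _ =>
      (integrable_coord_mul _ _).const_mul _

lemma integral_rowForm_self {e : κ → η → ι} (he : Function.Injective (Function.uncurry e))
    (Θ : η → η → ℝ) (k : κ) :
    ∫ w, rowForm e Θ k k w ∂stdGaussian (EuclideanSpace ℝ ι) = ∑ p, Θ p p := by
  classical
  have hinj : ∀ p q, e k p = e k q ↔ p = q := fun p q =>
    ⟨fun h => (Prod.ext_iff.1 (he (a₁ := (k, p)) (a₂ := (k, q)) h)).2, fun h => h ▸ rfl⟩
  simp_rw [rowForm_eq_sum]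
  simp_rw [← Fintype.sum_prod_type']
  rw [integral_finsetSum]
  swap
  · exact fun x _ => (integrable_coord_mul _ _).const_mul _
  simp [integral_const_mul, integral_coord_mul, hinj, Fintype.sum_prod_type]

/-- Of the three Isserlis pairings, the one matching row `k` with itself and row `k'` with itself
always contributes, giving the Frobenius norm. The other two match row `k` with row `k'` and survive
only when the rows coincide. -/
lemma integral_rowForm_sq [DecidableEq κ] {e : κ → η → ι}
    (he : Function.Injective (Function.uncurry e))
    (Θ : η → η → ℝ) (k k' : κ) :
    ∫ w, rowForm e Θ k k' w ^ 2 ∂stdGaussian (EuclideanSpace ℝ ι) =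
      (∑ p, ∑ q, Θ p q ^ 2) +
        if k = k' then (∑ p, Θ p p) ^ 2 + ∑ p, ∑ q, Θ p q * Θ q p else 0 := by
  classical
  have hinj : ∀ a b p q, e a p = e b q ↔ a = b ∧ p = q := fun a b p q =>
    ⟨fun h => Prod.ext_iff.1 (he (a₁ := (a, p)) (a₂ := (b, q)) h), fun h => by rw [h.1, h.2]⟩
  simp_rw [rowForm_sq]
  rw [integral_finsetSum]
  swap
  · exact fun x _ => (integrable_coord_mul_four _ _ _ _).const_mul _
  simp_rw [integral_const_mul, integral_coord_mul_four, hinj]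
  simp only [true_and, Fintype.sum_prod_type]
  by_cases hk : k = k'
  · subst hk
    simp only [true_and, if_true, mul_add, Finset.sum_add_distrib]
    have e1 : ∑ p, ∑ q, ∑ r, ∑ s, Θ p q * Θ r s * ((if p = q then 1 else 0) *
        (if r = s then 1 else 0)) = (∑ p, Θ p p) ^ 2 := by
      simp [sq, Finset.sum_mul_sum]
    have e2 : ∑ p, ∑ q, ∑ r, ∑ s, Θ p q * Θ r s * ((if p = r then 1 else 0) *
        (if q = s then 1 else 0)) = ∑ p, ∑ q, Θ p q ^ 2 := by
      simp [sq]
    have e3 : ∑ p, ∑ q, ∑ r, ∑ s, Θ p q * Θ r s * ((if p = s then 1 else 0) *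
        (if q = r then 1 else 0)) = ∑ p, ∑ q, Θ p q * Θ q p := by
      simp
    rw [e1, e2, e3]
    ring
  · have hk' : ¬ k' = k := fun h => hk h.symm
    simp [hk, hk', sq]

lemma integral_rowForm_sq_le [DecidableEq κ] {e : κ → η → ι}
    (he : Function.Injective (Function.uncurry e))
    (Θ : η → η → ℝ) (k k' : κ) :
    ∫ w, rowForm e Θ k k' w ^ 2 ∂stdGaussian (EuclideanSpace ℝ ι) ≤
      (∑ p, ∑ q, Θ p q ^ 2) +
        if k = k' then (∑ p, Θ p p) ^ 2 + ∑ p, ∑ q, Θ p q ^ 2 else 0 := by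
  rw [integral_rowForm_sq he]
  have := sum_sum_mul_swap_le Θ
  split_ifs <;> linarith

lemma integrable_rowForm_sub_sq (e : κ → η → ι) (Θ : η → η → ℝ) (k : κ) (c : ℝ) :
    Integrable (fun w => (rowForm e Θ k k w - c) ^ 2) (stdGaussian (EuclideanSpace ℝ ι)) := by
  have h1 := integrable_rowForm_sq e Θ k k (ι := ι)
  have h2 := integrable_rowForm e Θ k k (ι := ι)
  simp_rw [sub_sq]
  fun_prop

/-- The squared trace in the second moment cancels against the squared mean, leaving the Frobenius
term and the transpose term. -/
lemma integral_rowForm_sub_trace_sq_le {e : κ → η → ι}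
    (he : Function.Injective (Function.uncurry e)) (Θ : η → η → ℝ) (k : κ) :
    ∫ w, (rowForm e Θ k k w - ∑ p, Θ p p) ^ 2 ∂stdGaussian (EuclideanSpace ℝ ι) ≤
      2 * ∑ p, ∑ q, Θ p q ^ 2 := by
  classical
  have h1 := integrable_rowForm_sq e Θ k k (ι := ι)
  have h2 := integrable_rowForm e Θ k k (ι := ι)
  simp_rw [sub_sq]
  rw [integral_add, integral_sub, integral_mul_const, integral_const_mul,
    integral_rowForm_self he, integral_rowForm_sq he, if_pos rfl]
  any_goals fun_prop
  have := sum_sum_mul_swap_le Θ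
  simp
  nlinarith

end QuadraticForms

/-! ### The chain-rule gradient and the recursion for the tangent kernel. -/

section Network

variable {d m L : ℕ}

/-- The pre-activation `W^(l+1) α^(l)(x)`. -/
noncomputable def preactivation (w : Param d m L) (x : EuclideanSpace ℝ (Fin d)) (l : ℕ)
    (i : Fin (layerWidth d m (l + 1))) : ℝ :=
  (hiddenWeight w l).mulVec (embedding w x l) i

lemma preactivation_eq_sum (w : Param d m L) (x : EuclideanSpace ℝ (Fin d)) (l : ℕ)
    (i : Fin (layerWidth d m (l + 1))) :
    preactivation w x l i = ∑ j, hiddenWeight w l i j * embedding w x l j := rfl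

/-- The scaling factor of the hidden layers. -/
noncomputable def layerScale (m : ℕ) : ℝ := Real.sqrt 2 / Real.sqrt m

lemma layerScale_sq (m : ℕ) : layerScale m ^ 2 = 2 * (m : ℝ)⁻¹ := by
  rw [layerScale, div_pow, Real.sq_sqrt (by norm_num), Real.sq_sqrt (by positivity), div_eq_mul_inv]

lemma layerScale_pos {m : ℕ} (hm : 0 < m) : 0 < layerScale m := by
  have : (0 : ℝ) < m := by positivity
  unfold layerScale
  positivity

lemma embedding_succ_apply (w : Param d m L) (x : EuclideanSpace ℝ (Fin d)) (l : ℕ)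
    (i : Fin (layerWidth d m (l + 1))) :
    embedding w x (l + 1) i = layerScale m * relu (preactivation w x l i) := rfl

/-- The partial gradient of the pre-activation of unit `i` of layer `l + 1` in the weights
of that layer. -/
noncomputable def hiddenFeature {d m : ℕ} (L l : ℕ) (i : Fin (layerWidth d m (l + 1)))
    (a : EuclideanSpace ℝ (Fin (layerWidth d m l))) : Param d m L :=
  if h : l < L then ∑ j, a j • EuclideanSpace.single (Sum.inl ⟨⟨l, h⟩, (i, j)⟩) 1 else 0

/-- The partial gradient of the output in the output weights. -/
noncomputable def outputFeature {d m L : ℕ} (a : EuclideanSpace ℝ (Fin (layerWidth d m L))) :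
    Param d m L :=
  ∑ j, a j • EuclideanSpace.single (Sum.inr j) 1

/-- The gradient of the entries of the embeddings in the parameters, computed by the chain rule
with the convention that the derivative of `relu` vanishes at the kink. -/
noncomputable def embeddingGradient (w : Param d m L) (x : EuclideanSpace ℝ (Fin d)) :
    (l : ℕ) → Fin (layerWidth d m l) → Param d m L
  | 0 => fun _ => 0
  | l + 1 => fun i => (layerScale m * reluDeriv (preactivation w x l i)) •
      (hiddenFeature L l i (embedding w x l) +
        ∑ j, hiddenWeight w l i j • embeddingGradient w x l j)

/-- The gradient of the network in the parameters, computed by the chain rule. -/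
noncomputable def formalGradient (w : Param d m L) (x : EuclideanSpace ℝ (Fin d)) : Param d m L :=
  outputFeature (embedding w x L) + ∑ j, outputWeight w j • embeddingGradient w x L j

lemma embeddingGradient_succ (w : Param d m L) (x : EuclideanSpace ℝ (Fin d)) (l : ℕ)
    (i : Fin (layerWidth d m (l + 1))) :
    embeddingGradient w x (l + 1) i = (layerScale m * reluDeriv (preactivation w x l i)) •
      (hiddenFeature L l i (embedding w x l) +
        ∑ j, hiddenWeight w l i j • embeddingGradient w x l j) := rfl

/-- Layer `l` only sees the weights below it, so it can be held fixed while the weights above it are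
resampled. -/
lemma embedding_congr {w w' : Param d m L} (x : EuclideanSpace ℝ (Fin d)) {l : ℕ}
    (h : ∀ k < l, hiddenWeight w k = hiddenWeight w' k) : embedding w x l = embedding w' x l := by
  induction l with
  | zero => rfl
  | succ l ih =>
    have h1 := ih fun k hk => h k (hk.trans (Nat.lt_succ_self l))
    ext i
    rw [embedding_succ_apply, embedding_succ_apply, preactivation, preactivation, h1,
      h l (Nat.lt_succ_self l)]

lemma embeddingGradient_congr {w w' : Param d m L} (x : EuclideanSpace ℝ (Fin d)) {l : ℕ}
    (h : ∀ k < l, hiddenWeight w k = hiddenWeight w' k) :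
    embeddingGradient w x l = embeddingGradient w' x l := by
  induction l with
  | zero => rfl
  | succ l ih =>
    have hl := fun k hk => h k (lt_trans hk (Nat.lt_succ_self l))
    have h1 := ih hl
    have h2 := embedding_congr x hl
    ext1 i
    rw [embeddingGradient_succ, embeddingGradient_succ, preactivation, preactivation, h1, h2,
      h l (Nat.lt_succ_self l)]

lemma measurable_hiddenWeight (l : ℕ) (i : Fin (layerWidth d m (l + 1)))
    (j : Fin (layerWidth d m l)) : Measurable fun w : Param d m L => hiddenWeight w l i j := by
  unfold hiddenWeight
  split_ifs
  · fun_prop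
  · fun_prop

lemma continuous_hiddenWeight (l : ℕ) (i : Fin (layerWidth d m (l + 1)))
    (j : Fin (layerWidth d m l)) : Continuous fun w : Param d m L => hiddenWeight w l i j := by
  unfold hiddenWeight
  split_ifs
  · fun_prop
  · fun_prop

lemma continuous_embedding (x : EuclideanSpace ℝ (Fin d)) (l : ℕ) :
    Continuous fun w : Param d m L => embedding w x l := by
  induction l with
  | zero => exact continuous_const
  | succ l ih =>
    refine (PiLp.continuous_toLp 2 _).comp (continuous_pi fun i => ?_)
    refine continuous_const.mul (continuous_relu.comp ?_)
    simp only [Matrix.mulVec, dotProduct]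
    refine continuous_finsetSum _ fun j _ => (continuous_hiddenWeight l i j).mul ?_
    exact (PiLp.continuous_apply 2 _ j).comp ih

lemma continuous_preactivation (x : EuclideanSpace ℝ (Fin d)) (l : ℕ)
    (i : Fin (layerWidth d m (l + 1))) :
    Continuous fun w : Param d m L => preactivation w x l i := by
  simp only [preactivation_eq_sum]
  exact continuous_finsetSum _ fun j _ => (continuous_hiddenWeight l i j).mul
    ((PiLp.continuous_apply 2 _ j).comp (continuous_embedding x l))

lemma continuous_hiddenFeature (l : ℕ) (i : Fin (layerWidth d m (l + 1))) :
    Continuous fun a => hiddenFeature (d := d) L l i a := by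
  unfold hiddenFeature
  split_ifs
  · exact continuous_finsetSum _ fun j _ => (PiLp.continuous_apply 2 _ j).smul continuous_const
  · exact continuous_const

lemma measurable_embeddingGradient (x : EuclideanSpace ℝ (Fin d)) (l : ℕ)
    (i : Fin (layerWidth d m l)) :
    Measurable fun w : Param d m L => embeddingGradient w x l i := by
  induction l with
  | zero => exact measurable_const
  | succ l ih =>
    refine Measurable.smul (measurable_const.mul
      (measurable_reluDeriv.comp (continuous_preactivation x l i).measurable)) ?_
    refine Measurable.add ((continuous_hiddenFeature l i).comp
      (continuous_embedding x l)).measurable ?_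
    exact Finset.measurable_sum _ fun j _ => (measurable_hiddenWeight l i j).smul (ih j)

lemma inner_hiddenFeature (l : ℕ) (hl : l < L) (i : Fin (layerWidth d m (l + 1)))
    (a : EuclideanSpace ℝ (Fin (layerWidth d m l))) (v : Param d m L) :
    ⟪hiddenFeature L l i a, v⟫ = ∑ j, a j * hiddenWeight v l i j := by
  simp [hiddenFeature, hiddenWeight, hl, sum_inner, real_inner_smul_left,
    EuclideanSpace.inner_single_left]

lemma inner_outputFeature (a : EuclideanSpace ℝ (Fin (layerWidth d m L))) (v : Param d m L) :
    ⟪outputFeature a, v⟫ = ∑ j, a j * outputWeight v j := by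
  simp [outputFeature, outputWeight, sum_inner, real_inner_smul_left,
    EuclideanSpace.inner_single_left]

lemma hiddenWeight_add (v w : Param d m L) (l : ℕ) :
    hiddenWeight (v + w) l = hiddenWeight v l + hiddenWeight w l := by
  ext i j
  by_cases h : l < L <;> simp [hiddenWeight, h]

lemma hiddenWeight_smul (c : ℝ) (w : Param d m L) (l : ℕ) :
    hiddenWeight (c • w) l = c • hiddenWeight w l := by
  ext i j
  by_cases h : l < L <;> simp [hiddenWeight, h]

/-- The weights of layer `l + 1`, as a linear function of the parameters. -/
def hiddenWeightLinear (d m L l : ℕ) : Param d m L →ₗ[ℝ]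
    Matrix (Fin (layerWidth d m (l + 1))) (Fin (layerWidth d m l)) ℝ where
  toFun w := hiddenWeight w l
  map_add' v w := hiddenWeight_add v w l
  map_smul' c w := hiddenWeight_smul c w l

lemma hiddenWeight_sum {κ : Type*} (s : Finset κ) (v : κ → Param d m L) (l : ℕ) :
    hiddenWeight (∑ k ∈ s, v k) l = ∑ k ∈ s, hiddenWeight (v k) l :=
  map_sum (hiddenWeightLinear d m L l) v s

lemma hiddenWeight_zero (l : ℕ) : hiddenWeight (0 : Param d m L) l = 0 :=
  map_zero (hiddenWeightLinear d m L l)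

lemma outputWeight_sum {κ : Type*} (s : Finset κ) (v : κ → Param d m L)
    (j : Fin (layerWidth d m L)) :
    outputWeight (∑ k ∈ s, v k) j = ∑ k ∈ s, outputWeight (v k) j := by
  simp [outputWeight]

lemma hiddenWeight_hiddenFeature {l : ℕ} (hl : l < L) (i k : Fin (layerWidth d m (l + 1)))
    (a : EuclideanSpace ℝ (Fin (layerWidth d m l))) (j : Fin (layerWidth d m l)) :
    hiddenWeight (hiddenFeature L l i a) l k j = if k = i then a j else 0 := by
  by_cases hk : k = i
  · subst hk
    simp [hiddenWeight, hiddenFeature, hl, Finset.sum_apply, Pi.single_apply]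
  · simp [hiddenWeight, hiddenFeature, hl, Finset.sum_apply, hk]

lemma hiddenWeight_hiddenFeature_of_ne {l l' : ℕ} (h : l' ≠ l)
    (i : Fin (layerWidth d m (l + 1))) (a : EuclideanSpace ℝ (Fin (layerWidth d m l))) :
    hiddenWeight (hiddenFeature L l i a) l' = 0 := by
  ext k j
  by_cases hl' : l' < L <;> by_cases hl : l < L <;>
    simp [hiddenWeight, hiddenFeature, hl, hl', Finset.sum_apply, h]

lemma outputWeight_hiddenFeature (l : ℕ) (i : Fin (layerWidth d m (l + 1)))
    (a : EuclideanSpace ℝ (Fin (layerWidth d m l))) (j : Fin (layerWidth d m L)) :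
    outputWeight (hiddenFeature L l i a) j = 0 := by
  by_cases hl : l < L <;> simp [outputWeight, hiddenFeature, hl, Finset.sum_apply]

lemma outputWeight_outputFeature (a : EuclideanSpace ℝ (Fin (layerWidth d m L)))
    (j : Fin (layerWidth d m L)) : outputWeight (outputFeature a) j = a j := by
  simp [outputWeight, outputFeature, Finset.sum_apply, Pi.single_apply]

/-- The gradients of the embedding at layer `l` vanish in the weights of the layers above. -/
lemma hiddenWeight_embeddingGradient (w : Param d m L) (x : EuclideanSpace ℝ (Fin d)) {l k : ℕ}
    (h : l ≤ k) (i : Fin (layerWidth d m l)) :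
    hiddenWeight (embeddingGradient w x l i) k = 0 := by
  induction l with
  | zero => exact hiddenWeight_zero k
  | succ l ih =>
    rw [embeddingGradient_succ, hiddenWeight_smul, hiddenWeight_add, hiddenWeight_sum,
      hiddenWeight_hiddenFeature_of_ne (by omega)]
    simp [hiddenWeight_smul, ih (by omega : l ≤ k)]

lemma outputWeight_embeddingGradient (w : Param d m L) (x : EuclideanSpace ℝ (Fin d)) (l : ℕ)
    (i : Fin (layerWidth d m l)) (j : Fin (layerWidth d m L)) :
    outputWeight (embeddingGradient w x l i) j = 0 := by
  induction l with
  | zero => rfl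
  | succ l ih =>
    have h1 := outputWeight_hiddenFeature l i (embedding w x l) j
    have h2 : outputWeight (∑ k, hiddenWeight w l i k • embeddingGradient w x l k) j = 0 := by
      rw [outputWeight_sum]
      refine Finset.sum_eq_zero fun k _ => ?_
      have := ih k
      simp only [outputWeight] at this ⊢
      simp [this]
    simp only [outputWeight] at h1 h2 ⊢
    rw [embeddingGradient_succ, PiLp.smul_apply, PiLp.add_apply, h1, h2]
    simp

/-- The tangent kernel of the entries of the embeddings. -/
noncomputable def tangentKernel (w : Param d m L) (x z : EuclideanSpace ℝ (Fin d)) (l : ℕ)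
    (i j : Fin (layerWidth d m l)) : ℝ :=
  ⟪embeddingGradient w x l i, embeddingGradient w z l j⟫

/-- The position of the weights of layer `l + 1` among the parameters. -/
def hiddenIndex (d m : ℕ) {L l : ℕ} (hl : l < L) (i : Fin (layerWidth d m (l + 1)))
    (j : Fin (layerWidth d m l)) : ParamIndex d m L :=
  Sum.inl ⟨⟨l, hl⟩, (i, j)⟩

lemma hiddenIndex_injective {l : ℕ} (hl : l < L) :
    Function.Injective (Function.uncurry (hiddenIndex d m hl)) := by
  rintro ⟨i, j⟩ ⟨i', j'⟩ h
  simpa [hiddenIndex] using h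

/-- The position of the output weights among the parameters, as a family with a single row. -/
def outputIndex (d m L : ℕ) (_ : Unit) (j : Fin (layerWidth d m L)) : ParamIndex d m L :=
  Sum.inr j

lemma outputIndex_injective : Function.Injective (Function.uncurry (outputIndex d m L)) := by
  rintro ⟨_, j⟩ ⟨_, j'⟩ h
  simpa [outputIndex] using h

lemma hiddenWeight_eq {l : ℕ} (hl : l < L) (w : Param d m L) (i : Fin (layerWidth d m (l + 1)))
    (j : Fin (layerWidth d m l)) : hiddenWeight w l i j = w (hiddenIndex d m hl i j) := by
  simp [hiddenWeight, hl, hiddenIndex]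

lemma inner_sum_smul_embeddingGradient {κ : Type*} [Fintype κ] (u v : κ → ℝ)
    (G H : κ → Param d m L) :
    ⟪∑ j, u j • G j, ∑ j, v j • H j⟫ = ∑ p, ∑ q, u p * ⟪G p, H q⟫ * v q := by
  rw [sum_inner]
  refine Finset.sum_congr rfl fun p _ => ?_
  rw [inner_sum]
  refine Finset.sum_congr rfl fun q _ => ?_
  rw [real_inner_smul_left, real_inner_smul_right]
  ring

/-- The gradient of a pre-activation is a part in the weights of its own layer plus a part in lower
layers; these are orthogonal. The own-layer parts of different units use different rows, whence the
Kronecker delta, and the lower parts form a quadratic form in the rows. -/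
lemma tangentKernel_succ {l : ℕ} (hl : l < L) (w : Param d m L) (x z : EuclideanSpace ℝ (Fin d))
    (i j : Fin (layerWidth d m (l + 1))) :
    tangentKernel w x z (l + 1) i j =
      layerScale m ^ 2 * (reluDeriv (preactivation w x l i) * reluDeriv (preactivation w z l j)) *
        ((if i = j then ⟪embedding w x l, embedding w z l⟫ else 0) +
          rowForm (hiddenIndex d m hl) (tangentKernel w x z l) i j w) := by
  have h1 : ∀ (x z : EuclideanSpace ℝ (Fin d)) (i j : Fin (layerWidth d m (l + 1))),
      ⟪hiddenFeature L l i (embedding w x l),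
        ∑ k, hiddenWeight w l j k • embeddingGradient w z l k⟫ = 0 := fun x z i j => by
    rw [inner_hiddenFeature l hl, hiddenWeight_sum]
    simp [hiddenWeight_smul, hiddenWeight_embeddingGradient]
  have h2 : ⟪hiddenFeature L l i (embedding w x l), hiddenFeature L l j (embedding w z l)⟫ =
      if i = j then ⟪embedding w x l, embedding w z l⟫ else 0 := by
    rw [inner_hiddenFeature l hl]
    simp_rw [hiddenWeight_hiddenFeature hl]
    split_ifs
    · simp [PiLp.inner_apply, mul_comm]
    · simp
  rw [tangentKernel, embeddingGradient, embeddingGradient, real_inner_smul_left,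
    real_inner_smul_right, inner_add_left, inner_add_right, inner_add_right, h2, h1,
    real_inner_comm (hiddenFeature L l j (embedding w z l)), h1, inner_sum_smul_embeddingGradient]
  simp only [rowForm, hiddenWeight_eq hl, tangentKernel]
  ring

/-- The same orthogonality at the output, whose weights form a single row. -/
lemma inner_formalGradient (w : Param d m L) (x z : EuclideanSpace ℝ (Fin d)) :
    ⟪formalGradient w x, formalGradient w z⟫ = ⟪embedding w x L, embedding w z L⟫ +
      rowForm (outputIndex d m L) (tangentKernel w x z L) () () w := by
  have h1 : ∀ x z : EuclideanSpace ℝ (Fin d), ⟪outputFeature (embedding w x L),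
      ∑ k, outputWeight w k • embeddingGradient w z L k⟫ = 0 := fun x z => by
    rw [inner_outputFeature]
    refine Finset.sum_eq_zero fun j _ => ?_
    rw [outputWeight_sum, Finset.sum_eq_zero, mul_zero]
    intro k _
    have := outputWeight_embeddingGradient w z L k j
    simp only [outputWeight] at this ⊢
    simp [this]
  rw [formalGradient, formalGradient, inner_add_left, inner_add_right, inner_add_right, h1,
    real_inner_comm (outputFeature (embedding w z L))
      (∑ k, outputWeight w k • embeddingGradient w x L k), h1,
    inner_sum_smul_embeddingGradient, inner_outputFeature]
  simp only [outputWeight_outputFeature]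
  simp [PiLp.inner_apply, mul_comm, rowForm, outputWeight, outputIndex, tangentKernel]

end Network

/-! ### Conditioning on all layers but one, and almost sure regularity. -/

section Resampling

variable {d m L : ℕ}

lemma initMeasure_eq_stdGaussian (d m L : ℕ) : initMeasure d m L = stdGaussian (Param d m L) :=
  map_pi_eq_stdGaussian

instance (d m L : ℕ) : IsProbabilityMeasure (initMeasure d m L) := by
  rw [initMeasure_eq_stdGaussian]; infer_instance

/-- The layer to which a parameter belongs. -/
def paramLayer : ParamIndex d m L → ℕ
  | Sum.inl k => k.1
  | Sum.inr _ => L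

/-- Replace the parameters of layer `l` of `w` by those of `v`. -/
def resample (l : ℕ) (w v : Param d m L) : Param d m L :=
  WithLp.toLp 2 fun i => if paramLayer i = l then v i else w i

/-- It suffices to test boxes. The preimage of a box is a product of two boxes, each side being
imposed in exactly one of the two copies. -/
lemma map_pi_ite {ι α : Type*} [Fintype ι] [MeasurableSpace α] (ν : Measure α)
    [IsProbabilityMeasure ν] (P : ι → Prop) [DecidablePred P] :
    ((Measure.pi fun _ : ι => ν).prod (Measure.pi fun _ : ι => ν)).map
      (fun q i => if P i then q.2 i else q.1 i) = Measure.pi fun _ : ι => ν := by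
  have hmeas : Measurable fun (q : (ι → α) × (ι → α)) (i : ι) => if P i then q.2 i else q.1 i :=
    measurable_pi_lambda _ fun i => by split_ifs <;> fun_prop
  symm
  refine Measure.pi_eq fun s hs => ?_
  rw [Measure.map_apply hmeas (MeasurableSet.univ_pi hs)]
  have h : (fun (q : (ι → α) × (ι → α)) (i : ι) => if P i then q.2 i else q.1 i) ⁻¹'
      Set.univ.pi s = (Set.univ.pi fun i => if P i then Set.univ else s i) ×ˢ
        (Set.univ.pi fun i => if P i then s i else Set.univ) := by
    ext q
    simp only [Set.mem_preimage, Set.mem_univ_pi, Set.mem_prod, ← forall_and]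
    refine forall_congr' fun i => ?_
    split_ifs <;> simp
  rw [h, Measure.prod_prod, Measure.pi_pi, Measure.pi_pi, ← Finset.prod_mul_distrib]
  refine Finset.prod_congr rfl fun i _ => ?_
  split_ifs <;> simp

lemma measurable_resample (l : ℕ) :
    Measurable fun q : Param d m L × Param d m L => resample l q.1 q.2 := by
  refine (WithLp.measurable_toLp 2 _).comp (measurable_pi_lambda _ fun i => ?_)
  split_ifs <;> fun_prop

/-- Resampling one layer preserves the law of the parameters at initialization. -/
lemma map_resample (l : ℕ) :
    ((initMeasure d m L).prod (initMeasure d m L)).map (fun q => resample l q.1 q.2) =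
      initMeasure d m L := by
  conv_rhs => rw [initMeasure, ← map_pi_ite (gaussianReal 0 1) (fun i => paramLayer i = l)]
  have hmeas : Measurable fun (q : (ParamIndex d m L → ℝ) × (ParamIndex d m L → ℝ))
      (i : ParamIndex d m L) => if paramLayer i = l then q.2 i else q.1 i :=
    measurable_pi_lambda _ fun i => by split_ifs <;> fun_prop
  rw [Measure.map_map (by fun_prop) hmeas, initMeasure, Measure.map_prod_map _ _ (by fun_prop)
    (by fun_prop), Measure.map_map (measurable_resample l) (by fun_prop)]
  rfl

/-- Tonelli for the resampled law: the integrand is the conditional probability of `S` given the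
parameters outside layer `l`. -/
lemma initMeasure_eq_lintegral_resample (l : ℕ) {S : Set (Param d m L)} (hS : MeasurableSet S) :
    initMeasure d m L S =
      ∫⁻ w, initMeasure d m L {v | resample l w v ∈ S} ∂initMeasure d m L := by
  conv_lhs => rw [← map_resample l]
  rw [Measure.map_apply (measurable_resample l) hS, Measure.prod_apply (measurable_resample l hS)]
  rfl

lemma hiddenWeight_resample_of_ne {l k : ℕ} (h : k ≠ l) (w v : Param d m L) :
    hiddenWeight (resample l w v) k = hiddenWeight w k := by
  ext i j
  by_cases hk : k < L <;> simp [hiddenWeight, resample, paramLayer, hk, h]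

lemma resample_hiddenIndex {l : ℕ} (hl : l < L) (w v : Param d m L)
    (i : Fin (layerWidth d m (l + 1))) (j : Fin (layerWidth d m l)) :
    resample l w v (hiddenIndex d m hl i j) = v (hiddenIndex d m hl i j) := by
  simp [hiddenIndex, resample, paramLayer]

lemma resample_outputIndex (w v : Param d m L) (u : Unit) (j : Fin (layerWidth d m L)) :
    resample L w v (outputIndex d m L u j) = v (outputIndex d m L u j) := by
  simp [outputIndex, resample, paramLayer]

lemma embedding_resample {l k : ℕ} (h : l ≤ k) (w v : Param d m L) (x : EuclideanSpace ℝ (Fin d)) :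
    embedding (resample k w v) x l = embedding w x l :=
  embedding_congr x fun _ hj => hiddenWeight_resample_of_ne (by omega) w v

lemma embeddingGradient_resample {l k : ℕ} (h : l ≤ k) (w v : Param d m L)
    (x : EuclideanSpace ℝ (Fin d)) :
    embeddingGradient (resample k w v) x l = embeddingGradient w x l :=
  embeddingGradient_congr x fun _ hj => hiddenWeight_resample_of_ne (by omega) w v

lemma tangentKernel_resample {l k : ℕ} (h : l ≤ k) (w v : Param d m L)
    (x z : EuclideanSpace ℝ (Fin d)) :
    tangentKernel (resample k w v) x z l = tangentKernel w x z l := by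
  ext i j
  rw [tangentKernel, embeddingGradient_resample h, embeddingGradient_resample h, tangentKernel]

/-- The pre-activation after resampling is an inner product of a row of the new weights
with the old embedding. -/
lemma preactivation_resample {l : ℕ} (hl : l < L) (w v : Param d m L)
    (x : EuclideanSpace ℝ (Fin d)) (i : Fin (layerWidth d m (l + 1))) :
    preactivation (resample l w v) x l i =
      ⟪embedding w x l, WithLp.toLp 2 fun j => v (hiddenIndex d m hl i j)⟫ := by
  rw [preactivation_eq_sum, embedding_resample le_rfl]
  simp [hiddenWeight_eq hl, resample_hiddenIndex, PiLp.inner_apply]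

/-- Either no unit of layer `l + 1` sits at the kink of `relu`, or the layer below is dead. -/
def IsRegularAt (w : Param d m L) (x : EuclideanSpace ℝ (Fin d)) : Prop :=
  ∀ l < L, ∀ i, preactivation w x l i ≠ 0 ∨ embedding w x l = 0

lemma measurableSet_preactivation_eq_zero (x : EuclideanSpace ℝ (Fin d)) (l : ℕ)
    (i : Fin (layerWidth d m (l + 1))) :
    MeasurableSet {w : Param d m L | ¬ (preactivation w x l i ≠ 0 ∨ embedding w x l = 0)} := by
  have h1 : MeasurableSet {w : Param d m L | preactivation w x l i = 0} :=
    (isClosed_eq (continuous_preactivation x l i) continuous_const).measurableSet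
  have h2 : MeasurableSet {w : Param d m L | embedding w x l = 0} :=
    (isClosed_singleton.preimage (continuous_embedding (m := m) (L := L) x l)).measurableSet
  exact (h1.compl.union h2).compl

lemma map_row_stdGaussian {ι κ η : Type*} [Fintype ι] [Fintype η]
    {e : κ → η → ι} (he : Function.Injective (Function.uncurry e)) (k : κ) :
    (stdGaussian (EuclideanSpace ℝ ι)).map
      (fun w => (WithLp.toLp 2 fun j => w (e k j) : EuclideanSpace ℝ η)) =
      stdGaussian (EuclideanSpace ℝ η) := by
  have hk : Function.Injective (e k) := fun p q h =>
    (Prod.ext_iff.1 (he (a₁ := (k, p)) (a₂ := (k, q)) h)).2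
  simp_rw [← map_pi_eq_stdGaussian]
  rw [← map_pi_comp_injective (gaussianReal 0 1) hk, Measure.map_map, Measure.map_map]
  · rfl
  all_goals fun_prop

/-- Given a nonzero embedding below, a resampled pre-activation is a nondegenerate Gaussian and so
almost surely nonzero. -/
lemma ae_isRegularAt (x : EuclideanSpace ℝ (Fin d)) :
    ∀ᵐ w ∂initMeasure d m L, IsRegularAt w x := by
  unfold IsRegularAt
  simp only [ae_all_iff]
  intro l hl i
  rw [ae_iff, initMeasure_eq_lintegral_resample l (measurableSet_preactivation_eq_zero x l i)]
  refine lintegral_eq_zero_of_ae_eq_zero (ae_of_all _ fun w => ?_)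
  by_cases ha : embedding w x l = 0
  · simp [embedding_resample le_rfl, ha]
  · have h := ae_inner_ne_zero_stdGaussian ha
    rw [← map_row_stdGaussian (hiddenIndex_injective (d := d) (m := m) hl) i] at h
    have h2 := ae_of_ae_map (by fun_prop) h
    rw [← initMeasure_eq_stdGaussian, ae_iff] at h2
    simpa [embedding_resample le_rfl, ha, preactivation_resample hl] using h2

end Resampling

/-! ### The chain-rule gradient is almost surely the true gradient. -/

section Differentiability

variable {d m L : ℕ}

lemma hasDerivAt_relu {t : ℝ} (ht : t ≠ 0) : HasDerivAt relu (reluDeriv t) t := by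
  rcases lt_or_gt_of_ne ht with h | h
  · have : relu =ᶠ[𝓝 t] fun _ => 0 := by
      filter_upwards [gt_mem_nhds h] with s hs
      simp [relu, le_of_lt hs]
    rw [reluDeriv, if_neg (not_lt.2 h.le)]
    exact (hasDerivAt_const t (0 : ℝ)).congr_of_eventuallyEq this
  · have : relu =ᶠ[𝓝 t] fun s => s := by
      filter_upwards [lt_mem_nhds h] with s hs
      simp [relu, le_of_lt hs]
    rw [reluDeriv, if_pos h]
    exact (hasDerivAt_id t).congr_of_eventuallyEq this

/-- At regular parameters, a dead layer stays dead in a neighbourhood. -/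
lemma eventually_embedding_eq_zero {w : Param d m L} {x : EuclideanSpace ℝ (Fin d)}
    (hw : IsRegularAt w x) {l : ℕ} (hl : l ≤ L) (h0 : embedding w x l = 0) :
    ∀ᶠ w' in 𝓝 w, embedding w' x l = 0 := by
  induction l with
  | zero => exact Eventually.of_forall fun w' => h0
  | succ l ih =>
    by_cases ha : embedding w x l = 0
    · filter_upwards [ih (by omega) ha] with w' hw'
      ext i
      simp [embedding_succ_apply, preactivation_eq_sum, hw', relu]
    -- The layer dies although its input is nonzero: by regularity all pre-activations are strictly
    -- negative, which is an open condition. The unit `i` itself witnesses `0 < m`.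
    · have h : ∀ i, ∀ᶠ w' in 𝓝 w, preactivation w' x l i < 0 := fun i => by
        have hm : 0 < m := lt_of_le_of_lt (Nat.zero_le _) i.2
        have h1 : layerScale m * relu (preactivation w x l i) = 0 := by
          rw [← embedding_succ_apply, h0]; rfl
        have h2 : relu (preactivation w x l i) = 0 :=
          (mul_eq_zero.1 h1).resolve_left (layerScale_pos hm).ne'
        have h3 : preactivation w x l i ≠ 0 := (hw l (by omega) i).resolve_right ha
        have h4 : preactivation w x l i < 0 :=
          lt_of_le_of_ne (by rw [← h2]; exact le_max_right _ _) h3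
        exact (continuous_preactivation x l i).continuousAt.eventually_lt
          continuousAt_const h4
      filter_upwards [eventually_all.2 h] with w' hw'
      ext i
      simp [embedding_succ_apply, relu, (hw' i).le]

/-- An entry of a hidden weight matrix, as a continuous linear function of the parameters. -/
def hiddenWeightEntry (L l : ℕ) (i : Fin (layerWidth d m (l + 1)))
    (j : Fin (layerWidth d m l)) : Param d m L →L[ℝ] ℝ where
  toFun w := hiddenWeight w l i j
  map_add' v w := by rw [hiddenWeight_add]; rfl
  map_smul' c w := by rw [hiddenWeight_smul]; rfl
  cont := continuous_hiddenWeight l i j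

lemma hasFDerivAt_hiddenWeight (w : Param d m L) (l : ℕ) (i : Fin (layerWidth d m (l + 1)))
    (j : Fin (layerWidth d m l)) :
    HasFDerivAt (fun w : Param d m L => hiddenWeight w l i j) (hiddenWeightEntry L l i j) w :=
  (hiddenWeightEntry L l i j).hasFDerivAt

/-- If the layer below is nonzero, the chain rule applies away from the kink. If it is zero, the
entry vanishes in a neighbourhood, and the formal gradient also vanishes thanks to `reluDeriv 0 =
0`. -/
lemma hasFDerivAt_embedding {w : Param d m L} {x : EuclideanSpace ℝ (Fin d)}
    (hw : IsRegularAt w x) {l : ℕ} (hl : l ≤ L) (i : Fin (layerWidth d m l)) :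
    HasFDerivAt (fun w : Param d m L => embedding w x l i)
      (innerSL ℝ (embeddingGradient w x l i)) w := by
  induction l with
  | zero =>
    simp only [embedding, embeddingGradient, map_zero]
    exact hasFDerivAt_const _ _
  | succ l ih =>
    by_cases ha : embedding w x l = 0
    · have h0 : (fun w' : Param d m L => embedding w' x (l + 1) i) =ᶠ[𝓝 w] fun _ => 0 := by
        filter_upwards [eventually_embedding_eq_zero hw (by omega) ha] with w' hw'
        simp [embedding_succ_apply, preactivation_eq_sum, hw', relu]
      have h1 : embeddingGradient w x (l + 1) i = 0 := by
        simp [embeddingGradient_succ, preactivation_eq_sum, ha, reluDeriv]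
      rw [h1, map_zero]
      exact (hasFDerivAt_const (0 : ℝ) w).congr_of_eventuallyEq h0
    · have hp : HasFDerivAt (fun w' : Param d m L => preactivation w' x l i)
          (innerSL ℝ (hiddenFeature L l i (embedding w x l) +
            ∑ j, hiddenWeight w l i j • embeddingGradient w x l j)) w := by
        simp only [preactivation_eq_sum]
        refine (HasFDerivAt.fun_sum fun j _ => (hasFDerivAt_hiddenWeight w l i j).mul
          (ih (by omega) j)).congr_fderiv ?_
        ext v
        have he : ∀ j, hiddenWeightEntry L l i j v = hiddenWeight v l i j := fun _ => rfl
        simp [inner_hiddenFeature l (by omega : l < L), he, Finset.sum_add_distrib, add_comm]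
      have hr := (hasDerivAt_relu ((hw l (by omega) i).resolve_right ha)).comp_hasFDerivAt w hp
      refine (hr.const_mul (layerScale m)).congr_fderiv ?_
      ext v
      simp [embeddingGradient_succ, mul_assoc]

lemma hasGradientAt_reluNetwork {w : Param d m L} {x : EuclideanSpace ℝ (Fin d)}
    (hw : IsRegularAt w x) : HasGradientAt (reluNetwork d m L x) (formalGradient w x) w := by
  rw [hasGradientAt_iff_hasFDerivAt]
  have ho : ∀ j : Fin (layerWidth d m L), HasFDerivAt (fun w : Param d m L => outputWeight w j)
      (EuclideanSpace.proj (Sum.inr j) : Param d m L →L[ℝ] ℝ) w := fun j =>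
    (EuclideanSpace.proj (Sum.inr j) : Param d m L →L[ℝ] ℝ).hasFDerivAt
  refine (HasFDerivAt.fun_sum fun j _ => (ho j).mul
    (hasFDerivAt_embedding hw le_rfl j)).congr_fderiv ?_
  ext v
  have := inner_outputFeature (embedding w x L) v
  simp [formalGradient, this, Finset.sum_add_distrib, add_comm, outputWeight]

lemma ae_modelGradient_eq (x : EuclideanSpace ℝ (Fin d)) :
    ∀ᵐ w ∂initMeasure d m L, modelGradient w x = formalGradient w x := by
  filter_upwards [ae_isRegularAt x] with w hw
  exact (hasGradientAt_reluNetwork hw).gradient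

lemma ae_differentiableAt_reluNetwork (x : EuclideanSpace ℝ (Fin d)) :
    ∀ᵐ w ∂initMeasure d m L, DifferentiableAt ℝ (reluNetwork d m L x) w := by
  filter_upwards [ae_isRegularAt x] with w hw
  exact (hasGradientAt_reluNetwork hw).differentiableAt

end Differentiability

/-! ### Convergence in probability as convergence along a filter. -/

section InitFilter

variable {d L : ℕ}

/-- The filter of events whose probability at initialization tends to one as the width tends
to infinity. Convergence along this filter is convergence in probability. -/
def initFilter (d L : ℕ) : Filter (Σ m, Param d m L) where
  sets := {S | Tendsto (fun m => initMeasure d m L {w | (⟨m, w⟩ : Σ m, Param d m L) ∉ S})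
    atTop (𝓝 0)}
  univ_sets := by simp
  sets_of_superset {S T} hS hST := tendsto_of_tendsto_of_tendsto_of_le_of_le tendsto_const_nhds hS
    (fun _ => zero_le) fun m => measure_mono fun w hw h => hw (hST h)
  inter_sets {S T} hS hT := by
    have h := Tendsto.add hS hT
    rw [add_zero] at h
    refine tendsto_of_tendsto_of_tendsto_of_le_of_le tendsto_const_nhds h (fun _ => zero_le)
      fun m => (measure_mono fun w hw => ?_).trans (measure_union_le _ _)
    by_contra h'
    simp only [Set.mem_union, Set.mem_ofPred_eq, not_or, not_not] at h'
    exact hw h'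

lemma eventually_initFilter_iff {P : (Σ m, Param d m L) → Prop} :
    (∀ᶠ p in initFilter d L, P p) ↔
      Tendsto (fun m => initMeasure d m L {w | ¬ P ⟨m, w⟩}) atTop (𝓝 0) := Iff.rfl

/-- The parameter space changes with `m`, so all widths are gathered in one sigma type. Sums,
products, quotients and continuous images of limits in probability then come from the calculus of
`Tendsto`. -/
lemma tendstoInProbAtInit_iff {X : (m : ℕ) → Param d m L → ℝ} {c : ℝ} :
    TendstoInProbAtInit d L X c ↔
      Tendsto (fun p : Σ m, Param d m L => X p.1 p.2) (initFilter d L) (𝓝 c) := by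
  simp only [Metric.tendsto_nhds, eventually_initFilter_iff, TendstoInProbAtInit, Real.dist_eq,
    not_lt]

lemma eventually_initFilter_of_ae {P : (Σ m, Param d m L) → Prop}
    (h : ∀ m, ∀ᵐ w ∂initMeasure d m L, P ⟨m, w⟩) : ∀ᶠ p in initFilter d L, P p := by
  rw [eventually_initFilter_iff]
  refine tendsto_const_nhds.congr fun m => (ae_iff.1 (h m)).symm

lemma tendsto_width_initFilter : Tendsto (fun p : Σ m, Param d m L => p.1) (initFilter d L)
    atTop := by
  rw [tendsto_atTop]
  intro n
  rw [eventually_initFilter_iff]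
  refine tendsto_const_nhds.congr' ?_
  filter_upwards [eventually_ge_atTop n] with m hm
  simp [hm]

lemma eventually_width_pos : ∀ᶠ p in initFilter d L, 0 < p.1 :=
  tendsto_width_initFilter.eventually_gt_atTop 0

lemma tendsto_inv_width : Tendsto (fun p : Σ m, Param d m L => (p.1 : ℝ)⁻¹) (initFilter d L)
    (𝓝 0) :=
  tendsto_inv_atTop_zero.comp (tendsto_natCast_atTop_atTop.comp tendsto_width_initFilter)

/-- A nonnegative quantity tends to zero in probability if its expectation over the weights of
one layer, given all the other weights, does so. -/
lemma tendsto_zero_of_resample (l : ℕ) {Z : (m : ℕ) → Param d m L → ℝ}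
    (hZ : ∀ m, Measurable (Z m)) (hnn : ∀ m w, 0 ≤ Z m w) {e : (Σ m, Param d m L) → ℝ}
    (he : Tendsto e (initFilter d L) (𝓝 0))
    (h : ∀ᶠ p in initFilter d L,
      Integrable (fun v => Z p.1 (resample l p.2 v)) (initMeasure d p.1 L) ∧
      ∫ v, Z p.1 (resample l p.2 v) ∂initMeasure d p.1 L ≤ e p) :
    Tendsto (fun p : Σ m, Param d m L => Z p.1 p.2) (initFilter d L) (𝓝 0) := by
  rw [← tendstoInProbAtInit_iff]
  intro ε hε
  rw [ENNReal.tendsto_nhds_zero]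
  intro δ hδ
  obtain ⟨η, hη, hηδ⟩ : ∃ η : ℝ, 0 < η ∧ ENNReal.ofReal η ≤ δ / 2 := by
    obtain ⟨r, hr0, hr⟩ := ENNReal.lt_iff_exists_nnreal_btwn.1 (ENNReal.half_pos hδ.ne')
    exact ⟨r, by simpa using hr0, by simpa using hr.le⟩
  have hgood := h.and (he.eventually_lt_const (mul_pos hε hη))
  rw [eventually_initFilter_iff, ENNReal.tendsto_nhds_zero] at hgood
  filter_upwards [hgood (δ / 2) (ENNReal.half_pos hδ.ne')] with m hm
  -- The exceptional outer parameters. On `B` the conditional probability is bounded by `1`; off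
  -- `B`, Markov's inequality and `e < ε * η` bound it by `η`. Measurability of `B` is not needed
  -- for the upper bound on the integral of its indicator.
  set B : Set (Param d m L) := {w | ¬ ((Integrable (fun v => Z m (resample l w v))
    (initMeasure d m L) ∧ ∫ v, Z m (resample l w v) ∂initMeasure d m L ≤ e ⟨m, w⟩) ∧
      e ⟨m, w⟩ < ε * η)} with hB
  have hS : MeasurableSet {w | ε ≤ |Z m w - 0|} :=
    measurableSet_le measurable_const (by simpa using (hZ m).abs)
  rw [initMeasure_eq_lintegral_resample l hS]
  calc ∫⁻ w, initMeasure d m L {v | resample l w v ∈ {w | ε ≤ |Z m w - 0|}} ∂initMeasure d m L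
      ≤ ∫⁻ w, (B.indicator 1 w + ENNReal.ofReal η) ∂initMeasure d m L := by
        refine lintegral_mono fun w => ?_
        by_cases hw : w ∈ B
        · rw [Set.indicator_of_mem hw]
          exact prob_le_one.trans (le_add_right le_rfl)
        · have hw' : (Integrable (fun v => Z m (resample l w v)) (initMeasure d m L) ∧
            ∫ v, Z m (resample l w v) ∂initMeasure d m L ≤ e ⟨m, w⟩) ∧ e ⟨m, w⟩ < ε * η := by
            by_contra hc
            exact hw hc
          refine le_trans ?_ (le_add_left le_rfl)
          have h1 := mul_meas_ge_le_integral_of_nonneg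
            (ae_of_all _ fun v => hnn m (resample l w v)) hw'.1.1 ε
          have h2 : (initMeasure d m L).real {v | ε ≤ Z m (resample l w v)} ≤ η :=
            le_of_mul_le_mul_left (h1.trans (hw'.1.2.trans hw'.2.le)) hε
          have h3 : {v | resample l w v ∈ {w | ε ≤ |Z m w - 0|}} =
              {v | ε ≤ Z m (resample l w v)} := by
            ext v
            simp [abs_of_nonneg (hnn m _)]
          rw [h3]
          exact (ENNReal.le_ofReal_iff_toReal_le (measure_ne_top _ _) hη.le).2 h2
    _ = ∫⁻ w, B.indicator 1 w ∂initMeasure d m L + ENNReal.ofReal η := by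
        rw [lintegral_add_right _ measurable_const]
        simp
    _ ≤ δ / 2 + δ / 2 := add_le_add ((lintegral_indicator_one_le B).trans hm) hηδ
    _ = δ := ENNReal.add_halves δ

end InitFilter

/-! ### Scalar statistics of a layer and their exact recursions. -/

section LayerStep

variable {d m L : ℕ}

lemma rowForm_resample {l : ℕ} (hl : l < L)
    (Θ : Fin (layerWidth d m l) → Fin (layerWidth d m l) → ℝ)
    (i j : Fin (layerWidth d m (l + 1))) (w v : Param d m L) :
    rowForm (hiddenIndex d m hl) Θ i j (resample l w v) = rowForm (hiddenIndex d m hl) Θ i j v := by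
  simp [rowForm, resample_hiddenIndex]

lemma inner_embedding_succ (w : Param d m L) (x z : EuclideanSpace ℝ (Fin d)) (l : ℕ) :
    ⟪embedding w x (l + 1), embedding w z (l + 1)⟫ =
      2 * ((m : ℝ)⁻¹ * ∑ i, relu (preactivation w x l i) * relu (preactivation w z l i)) := by
  rw [← mul_assoc, ← layerScale_sq, Finset.mul_sum, PiLp.inner_apply]
  refine Finset.sum_congr rfl fun i _ => ?_
  simp only [embedding_succ_apply, RCLike.inner_apply, conj_trivial]
  ring

/-- The trace of the tangent kernel. -/
noncomputable def kernelTrace (w : Param d m L) (x z : EuclideanSpace ℝ (Fin d)) (l : ℕ) : ℝ :=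
  ∑ i, tangentKernel w x z l i i

/-- The squared Frobenius norm of the tangent kernel. -/
noncomputable def kernelNormSq (w : Param d m L) (x z : EuclideanSpace ℝ (Fin d)) (l : ℕ) : ℝ :=
  ∑ i, ∑ j, tangentKernel w x z l i j ^ 2

lemma kernelNormSq_nonneg (w : Param d m L) (x z : EuclideanSpace ℝ (Fin d)) (l : ℕ) :
    0 ≤ kernelNormSq w x z l :=
  Finset.sum_nonneg fun _ _ => Finset.sum_nonneg fun _ _ => sq_nonneg _

lemma kernelTrace_resample {l k : ℕ} (h : l ≤ k) (w v : Param d m L)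
    (x z : EuclideanSpace ℝ (Fin d)) :
    kernelTrace (resample k w v) x z l = kernelTrace w x z l := by
  rw [kernelTrace, tangentKernel_resample h, kernelTrace]

/-- The deviation of the quadratic forms in the trace of the next tangent kernel. -/
noncomputable def traceDeviation {l : ℕ} (hl : l < L) (w : Param d m L)
    (x z : EuclideanSpace ℝ (Fin d)) : ℝ :=
  (m : ℝ)⁻¹ * ∑ i, reluDeriv (preactivation w x l i) * reluDeriv (preactivation w z l i) *
    (rowForm (hiddenIndex d m hl) (tangentKernel w x z l) i i w - kernelTrace w x z l)

/-- The fraction of the units of layer `l + 1` which are active on both inputs. -/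
noncomputable def activeFraction (w : Param d m L) (x z : EuclideanSpace ℝ (Fin d)) (l : ℕ) : ℝ :=
  (m : ℝ)⁻¹ * ∑ i, reluDeriv (preactivation w x l i) * reluDeriv (preactivation w z l i)

/-- Each diagonal quadratic form is replaced by the trace around which it concentrates. The trace
then factors out of the average over units, and the error is `traceDeviation`. -/
lemma kernelTrace_succ {l : ℕ} (hl : l < L) (w : Param d m L) (x z : EuclideanSpace ℝ (Fin d)) :
    kernelTrace w x z (l + 1) = 2 * traceDeviation hl w x z +
      2 * activeFraction w x z l * (⟪embedding w x l, embedding w z l⟫ + kernelTrace w x z l) := by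
  rw [kernelTrace, traceDeviation, activeFraction]
  simp_rw [tangentKernel_succ hl, layerScale_sq, if_pos, mul_sub, Finset.sum_sub_distrib,
    mul_add, Finset.sum_add_distrib, ← Finset.sum_mul, mul_assoc, ← Finset.mul_sum]
  ring

/-- The activation factors are at most `1`. The constant is `8 = 2² · 2`: the squared scale `2/m`,
and `(a + b)² ≤ 2 (a² + b²)`. -/
lemma kernelNormSq_succ_le {l : ℕ} (hl : l < L) (w : Param d m L)
    (x z : EuclideanSpace ℝ (Fin d)) :
    kernelNormSq w x z (l + 1) ≤ 8 * (m : ℝ)⁻¹ ^ 2 * ∑ i, ∑ j,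
      ((if i = j then ⟪embedding w x l, embedding w z l⟫ ^ 2 else 0) +
        rowForm (hiddenIndex d m hl) (tangentKernel w x z l) i j w ^ 2) := by
  rw [kernelNormSq, Finset.mul_sum]
  refine Finset.sum_le_sum fun i _ => ?_
  rw [Finset.mul_sum]
  refine Finset.sum_le_sum fun j _ => ?_
  rw [tangentKernel_succ hl, layerScale_sq]
  set s := reluDeriv (preactivation w x l i) * reluDeriv (preactivation w z l j)
  set q := rowForm (hiddenIndex d m hl) (tangentKernel w x z l) i j w
  have hs0 : 0 ≤ s := mul_nonneg (reluDeriv_nonneg _) (reluDeriv_nonneg _)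
  have hs1 : s ≤ 1 := mul_le_one₀ (reluDeriv_le_one _) (reluDeriv_nonneg _) (reluDeriv_le_one _)
  have hs2 : s ^ 2 ≤ 1 := pow_le_one₀ hs0 hs1
  have h1 : ((if i = j then ⟪embedding w x l, embedding w z l⟫ else 0) + q) ^ 2 ≤
      2 * ((if i = j then ⟪embedding w x l, embedding w z l⟫ ^ 2 else 0) + q ^ 2) := by
    have := add_sq_le (a := if i = j then ⟪embedding w x l, embedding w z l⟫ else 0) (b := q)
    split_ifs at this ⊢ <;> simpa using this
  calc (2 * (m : ℝ)⁻¹ * s * ((if i = j then ⟪embedding w x l, embedding w z l⟫ else 0) + q)) ^ 2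
      = 4 * (m : ℝ)⁻¹ ^ 2 * (s ^ 2 *
        ((if i = j then ⟪embedding w x l, embedding w z l⟫ else 0) + q) ^ 2) := by ring
    _ ≤ 4 * (m : ℝ)⁻¹ ^ 2 * (1 *
        (2 * ((if i = j then ⟪embedding w x l, embedding w z l⟫ ^ 2 else 0) + q ^ 2))) := by
        gcongr
    _ = _ := by ring

lemma measurable_tangentKernel (x z : EuclideanSpace ℝ (Fin d)) (l : ℕ)
    (i j : Fin (layerWidth d m l)) :
    Measurable fun w : Param d m L => tangentKernel w x z l i j :=
  (measurable_embeddingGradient x l i).inner (measurable_embeddingGradient z l j)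

lemma measurable_kernelTrace (x z : EuclideanSpace ℝ (Fin d)) (l : ℕ) :
    Measurable fun w : Param d m L => kernelTrace w x z l :=
  Finset.measurable_sum _ fun i _ => measurable_tangentKernel x z l i i

lemma measurable_rowForm {κ : Type*} (x z : EuclideanSpace ℝ (Fin d)) (l : ℕ)
    (e : κ → Fin (layerWidth d m l) → ParamIndex d m L) (i j : κ) :
    Measurable fun w : Param d m L => rowForm e (tangentKernel w x z l) i j w := by
  unfold rowForm
  refine Finset.measurable_sum _ fun p _ => Finset.measurable_sum _ fun q _ => ?_
  have := measurable_tangentKernel (m := m) (L := L) x z l p q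
  fun_prop

lemma measurable_activeFraction (x z : EuclideanSpace ℝ (Fin d)) (l : ℕ) :
    Measurable fun w : Param d m L => activeFraction w x z l :=
  measurable_const.mul (Finset.measurable_sum _ fun i _ =>
    (measurable_reluDeriv.comp (continuous_preactivation x l i).measurable).mul
      (measurable_reluDeriv.comp (continuous_preactivation z l i).measurable))

lemma measurable_embeddingAngle (x z : EuclideanSpace ℝ (Fin d)) (l : ℕ) :
    Measurable fun w : Param d m L => embeddingAngle w x z l := by
  have hx := (continuous_embedding (m := m) (L := L) x l).measurable
  have hz := (continuous_embedding (m := m) (L := L) z l).measurable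
  unfold embeddingAngle InnerProductGeometry.angle
  exact Real.measurable_arccos.comp ((hx.inner hz).div (hx.norm.mul hz.norm))

end LayerStep

/-! ### Second moment bounds for the unitwise statistics. -/

section SecondMoments

variable {E : Type*} [NormedAddCommGroup E] [InnerProductSpace ℝ E]

lemma continuous_relu_mul_relu_inner (a b : E) :
    Continuous fun u : E => relu ⟪a, u⟫ * relu ⟪b, u⟫ :=
  (continuous_relu.comp (continuous_const.inner continuous_id)).mul
    (continuous_relu.comp (continuous_const.inner continuous_id))

/-- The right side has the shape of the integrand in Isserlis' formula. -/
lemma relu_mul_relu_sq_le (s t : ℝ) : (relu s * relu t) ^ 2 ≤ s * s * t * t := by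
  have h1 : relu s ^ 2 ≤ s ^ 2 := by
    rw [← sq_abs s]; exact pow_le_pow_left₀ (relu_nonneg s) (relu_le_abs s) 2
  have h2 : relu t ^ 2 ≤ t ^ 2 := by
    rw [← sq_abs t]; exact pow_le_pow_left₀ (relu_nonneg t) (relu_le_abs t) 2
  calc (relu s * relu t) ^ 2 = relu s ^ 2 * relu t ^ 2 := by ring
    _ ≤ s ^ 2 * t ^ 2 := by gcongr
    _ = s * s * t * t := by ring

variable [MeasurableSpace E] [BorelSpace E]

lemma measurable_reluDeriv_mul_reluDeriv_inner (a b : E) :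
    Measurable fun u : E => reluDeriv ⟪a, u⟫ * reluDeriv ⟪b, u⟫ :=
  (measurable_reluDeriv.comp (continuous_const.inner continuous_id).measurable).mul
    (measurable_reluDeriv.comp (continuous_const.inner continuous_id).measurable)

variable [FiniteDimensional ℝ E]

lemma integrable_relu_mul_relu_sq (a b : E) :
    Integrable (fun u : E => (relu ⟪a, u⟫ * relu ⟪b, u⟫) ^ 2) (stdGaussian E) :=
  (integrable_inner_mul_four_stdGaussian a a b b).mono'
    ((continuous_relu_mul_relu_inner a b).pow 2).aestronglyMeasurable
    (ae_of_all _ fun u => by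
      rw [Real.norm_of_nonneg (sq_nonneg _)]
      exact relu_mul_relu_sq_le _ _)

lemma memLp_relu_mul_relu (a b : E) :
    MemLp (fun u : E => relu ⟪a, u⟫ * relu ⟪b, u⟫) 2 (stdGaussian E) :=
  (memLp_two_iff_integrable_sq (continuous_relu_mul_relu_inner a b).aestronglyMeasurable).2
    (integrable_relu_mul_relu_sq a b)

lemma integral_relu_mul_relu_sq_le (a b : E) :
    ∫ u, (relu ⟪a, u⟫ * relu ⟪b, u⟫) ^ 2 ∂stdGaussian E ≤ 3 * ‖a‖ ^ 2 * ‖b‖ ^ 2 := by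
  have h := integral_mono (integrable_relu_mul_relu_sq a b)
    (integrable_inner_mul_four_stdGaussian a a b b) fun u => relu_mul_relu_sq_le _ _
  rw [integral_inner_mul_four_stdGaussian] at h
  refine h.trans ?_
  rw [real_inner_self_eq_norm_sq, real_inner_self_eq_norm_sq]
  have h1 : ⟪a, b⟫ * ⟪a, b⟫ ≤ ‖a‖ ^ 2 * ‖b‖ ^ 2 := by
    rw [← mul_pow, ← sq, ← sq_abs]
    exact pow_le_pow_left₀ (abs_nonneg _) (abs_real_inner_le_norm a b) 2
  linarith

lemma reluDeriv_mul_reluDeriv_mem_Icc (s t : ℝ) : reluDeriv s * reluDeriv t ∈ Set.Icc (0 : ℝ) 1 :=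
  ⟨mul_nonneg (reluDeriv_nonneg _) (reluDeriv_nonneg _),
    mul_le_one₀ (reluDeriv_le_one _) (reluDeriv_nonneg _) (reluDeriv_le_one _)⟩

lemma memLp_reluDeriv_mul_reluDeriv (a b : E) :
    MemLp (fun u : E => reluDeriv ⟪a, u⟫ * reluDeriv ⟪b, u⟫) 2 (stdGaussian E) :=
  MemLp.of_bound (measurable_reluDeriv_mul_reluDeriv_inner a b).aestronglyMeasurable 1
    (ae_of_all _ fun u => by
      have h := reluDeriv_mul_reluDeriv_mem_Icc ⟪a, u⟫ ⟪b, u⟫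
      rw [Real.norm_of_nonneg h.1]
      exact h.2)

lemma integral_reluDeriv_mul_reluDeriv_sq_le (a b : E) :
    ∫ u, (reluDeriv ⟪a, u⟫ * reluDeriv ⟪b, u⟫) ^ 2 ∂stdGaussian E ≤ 1 := by
  have h := integral_mono (memLp_reluDeriv_mul_reluDeriv a b).integrable_sq
    (integrable_const (1 : ℝ)) fun u => by
      have h := reluDeriv_mul_reluDeriv_mem_Icc ⟪a, u⟫ ⟪b, u⟫
      exact pow_le_one₀ h.1 h.2
  simpa using h

end SecondMoments

/-! ### Passing limits in probability through one layer. -/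

section LayerConvergence

variable {d L : ℕ} {x z : EuclideanSpace ℝ (Fin d)} {l : ℕ}

lemma tendsto_of_tendsto_sub_sq {α : Type*} {F : Filter α} {f g : α → ℝ} {c : ℝ}
    (hg : Tendsto g F (𝓝 c)) (h : Tendsto (fun p => (f p - g p) ^ 2) F (𝓝 0)) :
    Tendsto f F (𝓝 c) := by
  have h1 : Tendsto (fun p => f p - g p) F (𝓝 0) := by
    rw [tendsto_zero_iff_abs_tendsto_zero]
    have h2 := (Real.continuous_sqrt.tendsto 0).comp h
    rw [Real.sqrt_zero] at h2
    refine h2.congr fun p => ?_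
    simp [Real.sqrt_sq_eq_abs]
  have h3 := h1.add hg
  rw [zero_add] at h3
  exact h3.congr fun p => by ring

lemma tendsto_inner_embedding_succ (hl : l < L) {A B θ : ℝ}
    (hA : Tendsto (fun p : Σ m, Param d m L => ‖embedding p.2 x l‖) (initFilter d L) (𝓝 A))
    (hB : Tendsto (fun p : Σ m, Param d m L => ‖embedding p.2 z l‖) (initFilter d L) (𝓝 B))
    (hθ : Tendsto (fun p : Σ m, Param d m L => embeddingAngle p.2 x z l) (initFilter d L) (𝓝 θ)) :
    Tendsto (fun p : Σ m, Param d m L => ⟪embedding p.2 x (l + 1), embedding p.2 z (l + 1)⟫)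
      (initFilter d L) (𝓝 (A * B * (2 * reluKernel θ))) := by
  simp_rw [inner_embedding_succ]
  set mean : (m : ℕ) → Param d m L → ℝ := fun m w =>
    ‖embedding w x l‖ * ‖embedding w z l‖ * reluKernel (embeddingAngle w x z l) with hmean
  have hlim : Tendsto (fun p : Σ m, Param d m L => mean p.1 p.2) (initFilter d L)
      (𝓝 (A * B * reluKernel θ)) :=
    (hA.mul hB).mul ((continuous_reluKernel.tendsto θ).comp hθ)
  have hZ := tendsto_zero_of_resample (d := d) (L := L) l
    (Z := fun m w => ((m : ℝ)⁻¹ * ∑ i, relu (preactivation w x l i) * relu (preactivation w z l i)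
      - mean m w) ^ 2)
    -- The conditional variance bound of the average: a second moment of one unit, from Isserlis and
    -- Cauchy–Schwarz, divided by the width.
    (e := fun p => (3 * ‖embedding p.2 x l‖ ^ 2 * ‖embedding p.2 z l‖ ^ 2) * (p.1 : ℝ)⁻¹)
    (fun m => ?_) (fun m w => sq_nonneg _) ?_ ?_
  · have h := (tendsto_of_tendsto_sub_sq hlim hZ).const_mul 2
    rwa [show 2 * (A * B * reluKernel θ) = A * B * (2 * reluKernel θ) by ring] at h
  · have h1 : Measurable fun w : Param d m L => (m : ℝ)⁻¹ *
        ∑ i, relu (preactivation w x l i) * relu (preactivation w z l i) :=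
      (continuous_const.mul (continuous_finsetSum _ fun i _ =>
        (continuous_relu.comp (continuous_preactivation x l i)).mul
          (continuous_relu.comp (continuous_preactivation z l i)))).measurable
    have h2 : Measurable fun w : Param d m L => mean m w :=
      ((continuous_embedding x l).norm.mul (continuous_embedding z l).norm).measurable.mul
        (continuous_reluKernel.measurable.comp (measurable_embeddingAngle x z l))
    exact (h1.sub h2).pow_const 2
  · have h := (((hA.pow 2).const_mul 3).mul (hB.pow 2)).mul (tendsto_inv_width (d := d) (L := L))
    rwa [mul_zero] at h
  · filter_upwards [eventually_width_pos] with p hp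
    have h := integral_rows_average_sub_sq_le (m := p.1)
      (hiddenIndex_injective (d := d) (m := p.1) hl)
      (Fintype.card_fin _) hp
      (continuous_relu_mul_relu_inner (embedding p.2 x l) (embedding p.2 z l)).measurable
      (memLp_relu_mul_relu _ _)
    rw [integral_relu_mul_relu_stdGaussian, ← initMeasure_eq_stdGaussian] at h
    simp only [preactivation_resample hl, hmean, embeddingAngle, embedding_resample le_rfl]
    refine ⟨h.1, h.2.trans ?_⟩
    rw [div_eq_mul_inv]
    gcongr
    exact integral_relu_mul_relu_sq_le _ _

lemma tendsto_activeFraction (hl : l < L) {θ : ℝ}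
    (hx : ∀ᶠ p : Σ m, Param d m L in initFilter d L, embedding p.2 x l ≠ 0)
    (hz : ∀ᶠ p : Σ m, Param d m L in initFilter d L, embedding p.2 z l ≠ 0)
    (hθ : Tendsto (fun p : Σ m, Param d m L => embeddingAngle p.2 x z l) (initFilter d L) (𝓝 θ)) :
    Tendsto (fun p : Σ m, Param d m L => 2 * activeFraction p.2 x z l)
      (initFilter d L) (𝓝 (1 - θ / Real.pi)) := by
  set mean : (m : ℕ) → Param d m L → ℝ := fun m w =>
    (1 - embeddingAngle w x z l / Real.pi) / 2 with hmean
  have hlim : Tendsto (fun p : Σ m, Param d m L => mean p.1 p.2) (initFilter d L)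
      (𝓝 ((1 - θ / Real.pi) / 2)) :=
    ((hθ.div_const _).const_sub 1).div_const 2
  have hZ := tendsto_zero_of_resample (d := d) (L := L) l
    (Z := fun m w => (activeFraction w x z l - mean m w) ^ 2)
    (e := fun p => (p.1 : ℝ)⁻¹)
    (fun m => ?_) (fun m w => sq_nonneg _) tendsto_inv_width ?_
  · have h := (tendsto_of_tendsto_sub_sq hlim hZ).const_mul 2
    rwa [mul_div_cancel₀ _ two_ne_zero] at h
  · exact ((measurable_activeFraction x z l).sub ((measurable_const.sub
      ((measurable_embeddingAngle x z l).div_const _)).div_const 2)).pow_const 2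
  · filter_upwards [eventually_width_pos, hx, hz] with p hp hpx hpz
    have h := integral_rows_average_sub_sq_le (m := p.1)
      (hiddenIndex_injective (d := d) (m := p.1) hl)
      (Fintype.card_fin _) hp
      (measurable_reluDeriv_mul_reluDeriv_inner (embedding p.2 x l) (embedding p.2 z l))
      (memLp_reluDeriv_mul_reluDeriv _ _)
    have h2 : ∫ u, reluDeriv ⟪embedding p.2 x l, u⟫ * reluDeriv ⟪embedding p.2 z l, u⟫
        ∂stdGaussian (EuclideanSpace ℝ (Fin (layerWidth d p.1 l))) = mean p.1 p.2 := by
      have := integral_reluDeriv_mul_reluDeriv_stdGaussian hpx hpz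
      simp only [hmean, embeddingAngle]
      linarith
    rw [h2, ← initMeasure_eq_stdGaussian] at h
    simp only [activeFraction, preactivation_resample hl, hmean, embeddingAngle,
      embedding_resample le_rfl] at h ⊢
    refine ⟨h.1, h.2.trans ?_⟩
    rw [div_eq_mul_inv]
    exact mul_le_of_le_one_left (by positivity) (integral_reluDeriv_mul_reluDeriv_sq_le _ _)

/-- The activation factors depend on the same rows as the quadratic forms. Cauchy–Schwarz removes
them using only that they lie in `[0, 1]`, so no independence between the two is needed. -/
lemma traceDeviation_sq_le {m : ℕ} (hl : l < L) (w : Param d m L) (hm : 0 < m) :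
    traceDeviation hl w x z ^ 2 ≤ (m : ℝ)⁻¹ * ∑ i, (rowForm (hiddenIndex d m hl)
      (tangentKernel w x z l) i i w - kernelTrace w x z l) ^ 2 := by
  have hm' : (0 : ℝ) < m := by positivity
  rw [traceDeviation, mul_pow]
  have h1 := sq_sum_le_card_mul_sum_sq (s := (Finset.univ : Finset (Fin (layerWidth d m (l + 1)))))
    (f := fun i => reluDeriv (preactivation w x l i) * reluDeriv (preactivation w z l i) *
    (rowForm (hiddenIndex d m hl) (tangentKernel w x z l) i i w - kernelTrace w x z l))
  have hcard : (Finset.univ : Finset (Fin (layerWidth d m (l + 1)))).card = m :=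
    Finset.card_fin m
  rw [hcard] at h1
  calc _ ≤ (m : ℝ)⁻¹ ^ 2 * (m * ∑ i, (reluDeriv (preactivation w x l i) *
        reluDeriv (preactivation w z l i) * (rowForm (hiddenIndex d m hl)
        (tangentKernel w x z l) i i w - kernelTrace w x z l)) ^ 2) := by gcongr
    _ = (m : ℝ)⁻¹ * ∑ i, (reluDeriv (preactivation w x l i) *
        reluDeriv (preactivation w z l i) * (rowForm (hiddenIndex d m hl)
        (tangentKernel w x z l) i i w - kernelTrace w x z l)) ^ 2 := by field_simp
    _ ≤ _ := by
        refine mul_le_mul_of_nonneg_left (Finset.sum_le_sum fun i _ => ?_) (by positivity)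
        rw [mul_pow]
        have h := reluDeriv_mul_reluDeriv_mem_Icc (preactivation w x l i) (preactivation w z l i)
        exact mul_le_of_le_one_left (sq_nonneg _) (pow_le_one₀ h.1 h.2)

lemma tendsto_traceDeviation (hl : l < L)
    (hF : Tendsto (fun p : Σ m, Param d m L => kernelNormSq p.2 x z l) (initFilter d L) (𝓝 0)) :
    Tendsto (fun p : Σ m, Param d m L => traceDeviation hl p.2 x z) (initFilter d L) (𝓝 0) := by
  have hZ := tendsto_zero_of_resample (d := d) (L := L) l
    (Z := fun m w => (m : ℝ)⁻¹ * ∑ i, (rowForm (hiddenIndex d m hl)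
      (tangentKernel w x z l) i i w - kernelTrace w x z l) ^ 2)
    (e := fun p => 2 * kernelNormSq p.2 x z l)
    (fun m => ?_) (fun m w => ?_) (by simpa using hF.const_mul 2) ?_
  · refine tendsto_of_tendsto_sub_sq (tendsto_const_nhds (x := (0 : ℝ))) ?_
    refine tendsto_of_tendsto_of_tendsto_of_le_of_le' tendsto_const_nhds hZ
      (Eventually.of_forall fun p => sq_nonneg _) ?_
    filter_upwards [eventually_width_pos] with p hp
    rw [sub_zero]
    exact traceDeviation_sq_le hl p.2 hp
  · exact measurable_const.mul (Finset.measurable_sum _ fun i _ =>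
      ((measurable_rowForm x z l _ i i).sub (measurable_kernelTrace x z l)).pow_const 2)
  · exact mul_nonneg (by positivity) (Finset.sum_nonneg fun i _ => sq_nonneg _)
  · filter_upwards [eventually_width_pos] with p hp
    have hp' : (0 : ℝ) < p.1 := by positivity
    simp only [rowForm_resample, tangentKernel_resample le_rfl, kernelTrace_resample le_rfl]
    have hI : ∀ i, Integrable (fun v => (rowForm (hiddenIndex d p.1 hl)
        (tangentKernel p.2 x z l) i i v - kernelTrace p.2 x z l) ^ 2) (initMeasure d p.1 L) :=
      fun i => by
        rw [initMeasure_eq_stdGaussian]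
        exact integrable_rowForm_sub_sq _ _ _ _
    refine ⟨(integrable_finsetSum _ fun i _ => hI i).const_mul _, ?_⟩
    rw [integral_const_mul, integral_finsetSum _ fun i _ => hI i]
    have h1 : ∀ i, ∫ v, (rowForm (hiddenIndex d p.1 hl) (tangentKernel p.2 x z l) i i v -
        kernelTrace p.2 x z l) ^ 2 ∂initMeasure d p.1 L ≤ 2 * kernelNormSq p.2 x z l := fun i => by
      rw [initMeasure_eq_stdGaussian]
      exact integral_rowForm_sub_trace_sq_le (hiddenIndex_injective hl) _ i
    have h2 := Finset.sum_le_sum fun i (_ : i ∈ Finset.univ) => h1 i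
    rw [Finset.sum_const, show (Finset.univ : Finset (Fin (layerWidth d p.1 (l + 1)))).card = p.1
      from Finset.card_fin p.1, nsmul_eq_mul] at h2
    calc _ ≤ (p.1 : ℝ)⁻¹ * (p.1 * (2 * kernelNormSq p.2 x z l)) := by gcongr
      _ = _ := by field_simp

/-- All `m²` entries contribute a mean of `‖Θ_l‖_F²`, and the `m` diagonal ones an extra bounded
amount. After division by `m²` there remain a constant times `‖Θ_l‖_F²` and a term of order `1/m`.
-/
lemma tendsto_kernelNormSq_succ (hl : l < L) {C T : ℝ}
    (hC : Tendsto (fun p : Σ m, Param d m L => ⟪embedding p.2 x l, embedding p.2 z l⟫)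
      (initFilter d L) (𝓝 C))
    (hT : Tendsto (fun p : Σ m, Param d m L => kernelTrace p.2 x z l) (initFilter d L) (𝓝 T))
    (hF : Tendsto (fun p : Σ m, Param d m L => kernelNormSq p.2 x z l) (initFilter d L) (𝓝 0)) :
    Tendsto (fun p : Σ m, Param d m L => kernelNormSq p.2 x z (l + 1)) (initFilter d L)
      (𝓝 0) := by
  have hZ := tendsto_zero_of_resample (d := d) (L := L) l
    (Z := fun m w => 8 * (m : ℝ)⁻¹ ^ 2 * ∑ i, ∑ j,
      ((if i = j then ⟪embedding w x l, embedding w z l⟫ ^ 2 else 0) +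
        rowForm (hiddenIndex d m hl) (tangentKernel w x z l) i j w ^ 2))
    (e := fun p => 8 * (p.1 : ℝ)⁻¹ * (⟪embedding p.2 x l, embedding p.2 z l⟫ ^ 2 +
      kernelTrace p.2 x z l ^ 2 + kernelNormSq p.2 x z l) + 8 * kernelNormSq p.2 x z l)
    (fun m => ?_) (fun m w => ?_) ?_ ?_
  · exact tendsto_of_tendsto_of_tendsto_of_le_of_le tendsto_const_nhds hZ
      (fun p => kernelNormSq_nonneg _ _ _ _) fun p => kernelNormSq_succ_le hl p.2 x z
  · refine measurable_const.mul (Finset.measurable_sum _ fun i _ => Finset.measurable_sum _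
      fun j _ => Measurable.add ?_ ((measurable_rowForm x z l _ i j).pow_const 2))
    split_ifs
    · exact ((continuous_embedding x l).inner (continuous_embedding z l)).measurable.pow_const 2
    · exact measurable_const
  · refine mul_nonneg (by positivity) (Finset.sum_nonneg fun i _ => Finset.sum_nonneg fun j _ =>
      add_nonneg ?_ (sq_nonneg _))
    split_ifs <;> positivity
  · have h := ((tendsto_inv_width (d := d) (L := L)).const_mul 8).mul
      (((hC.pow 2).add (hT.pow 2)).add hF) |>.add (hF.const_mul 8)
    simpa using h
  · filter_upwards [eventually_width_pos] with p hp
    have hp' : (0 : ℝ) < p.1 := by positivity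
    simp only [rowForm_resample, tangentKernel_resample le_rfl, embedding_resample le_rfl]
    have hI : ∀ i j, Integrable (fun v => (if i = j then
        ⟪embedding p.2 x l, embedding p.2 z l⟫ ^ 2 else 0) + rowForm (hiddenIndex d p.1 hl)
        (tangentKernel p.2 x z l) i j v ^ 2) (initMeasure d p.1 L) := fun i j => by
      rw [initMeasure_eq_stdGaussian]
      exact (integrable_const _).add (integrable_rowForm_sq _ _ _ _)
    refine ⟨(integrable_finsetSum _ fun i _ => integrable_finsetSum _ fun j _ =>
      hI i j).const_mul _, ?_⟩
    rw [integral_const_mul, integral_finsetSum _ fun i _ => integrable_finsetSum _ fun j _ =>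
      hI i j]
    have h1 : ∀ i j, ∫ v, ((if i = j then
        ⟪embedding p.2 x l, embedding p.2 z l⟫ ^ 2 else 0) + rowForm (hiddenIndex d p.1 hl)
        (tangentKernel p.2 x z l) i j v ^ 2) ∂initMeasure d p.1 L ≤ kernelNormSq p.2 x z l +
        if i = j then ⟪embedding p.2 x l, embedding p.2 z l⟫ ^ 2 + kernelTrace p.2 x z l ^ 2 +
          kernelNormSq p.2 x z l else 0 := fun i j => by
      rw [initMeasure_eq_stdGaussian, integral_add (integrable_const _)
        (integrable_rowForm_sq _ _ _ _)]
      have h := integral_rowForm_sq_le (hiddenIndex_injective (d := d) (m := p.1) hl)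
        (tangentKernel p.2 x z l) i j
      rw [← kernelNormSq, ← kernelTrace] at h
      simp only [integral_const, probReal_univ, smul_eq_mul, one_mul]
      split_ifs at h ⊢ <;> linarith
    have h2 : ∀ i, ∫ v, ∑ j, ((if i = j then
        ⟪embedding p.2 x l, embedding p.2 z l⟫ ^ 2 else 0) + rowForm (hiddenIndex d p.1 hl)
        (tangentKernel p.2 x z l) i j v ^ 2) ∂initMeasure d p.1 L ≤
        p.1 * kernelNormSq p.2 x z l + (⟪embedding p.2 x l, embedding p.2 z l⟫ ^ 2 +
          kernelTrace p.2 x z l ^ 2 + kernelNormSq p.2 x z l) := fun i => by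
      rw [integral_finsetSum _ fun j _ => hI i j]
      refine (Finset.sum_le_sum fun j _ => h1 i j).trans (le_of_eq ?_)
      rw [Finset.sum_add_distrib, Finset.sum_const,
        show (Finset.univ : Finset (Fin (layerWidth d p.1 (l + 1)))).card = p.1
        from Finset.card_fin p.1, nsmul_eq_mul, Finset.sum_ite_eq]
      simp
    have h3 := Finset.sum_le_sum fun i (_ : i ∈ Finset.univ) => h2 i
    rw [Finset.sum_const, show (Finset.univ : Finset (Fin (layerWidth d p.1 (l + 1)))).card = p.1
      from Finset.card_fin p.1, nsmul_eq_mul] at h3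
    calc _ ≤ 8 * (p.1 : ℝ)⁻¹ ^ 2 * (p.1 * (p.1 * kernelNormSq p.2 x z l +
          (⟪embedding p.2 x l, embedding p.2 z l⟫ ^ 2 +
          kernelTrace p.2 x z l ^ 2 + kernelNormSq p.2 x z l))) := by gcongr
      _ = _ := by field_simp; ring

/-- The output layer has a single row, hence no averaging over units; the quadratic form still
concentrates because the Frobenius norm of the kernel tends to zero. -/
lemma tendsto_inner_formalGradient {C T : ℝ}
    (hC : Tendsto (fun p : Σ m, Param d m L => ⟪embedding p.2 x L, embedding p.2 z L⟫)
      (initFilter d L) (𝓝 C))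
    (hT : Tendsto (fun p : Σ m, Param d m L => kernelTrace p.2 x z L) (initFilter d L) (𝓝 T))
    (hF : Tendsto (fun p : Σ m, Param d m L => kernelNormSq p.2 x z L) (initFilter d L) (𝓝 0)) :
    Tendsto (fun p : Σ m, Param d m L => ⟪formalGradient p.2 x, formalGradient p.2 z⟫)
      (initFilter d L) (𝓝 (C + T)) := by
  simp_rw [inner_formalGradient]
  refine hC.add ?_
  have hZ := tendsto_zero_of_resample (d := d) (L := L) L
    (Z := fun m w => (rowForm (outputIndex d m L) (tangentKernel w x z L) () () w -
      kernelTrace w x z L) ^ 2)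
    (e := fun p => 2 * kernelNormSq p.2 x z L)
    (fun m => ?_) (fun m w => sq_nonneg _) (by simpa using hF.const_mul 2) ?_
  · exact tendsto_of_tendsto_sub_sq hT hZ
  · exact ((measurable_rowForm x z L _ () ()).sub (measurable_kernelTrace x z L)).pow_const 2
  · refine Eventually.of_forall fun p => ?_
    have h1 : ∀ v, rowForm (outputIndex d p.1 L) (tangentKernel p.2 x z L) () ()
        (resample L p.2 v) = rowForm (outputIndex d p.1 L) (tangentKernel p.2 x z L) () () v :=
      fun v => by simp [rowForm, resample_outputIndex]
    simp only [h1, tangentKernel_resample le_rfl, kernelTrace_resample le_rfl]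
    rw [initMeasure_eq_stdGaussian]
    exact ⟨integrable_rowForm_sub_sq _ _ _ _,
      integral_rowForm_sub_trace_sq_le outputIndex_injective _ ()⟩

end LayerConvergence

/-! ### The limiting recursions, their solution, and the limits of the angles. -/

section Limit

/-- The limits of the embedding angles, for inputs at angle `t`. -/
noncomputable def limitAngle (t : ℝ) : ℕ → ℝ
  | 0 => t
  | l + 1 => Real.arccos (2 * reluKernel (limitAngle t l))

/-- The limits of the traces of the tangent kernels, for unit inputs at angle `t`. -/
noncomputable def limitTrace (t : ℝ) : ℕ → ℝ
  | 0 => 0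
  | l + 1 => (1 - limitAngle t l / Real.pi) * (Real.cos (limitAngle t l) + limitTrace t l)

lemma limitAngle_mem_Icc {t : ℝ} (ht : t ∈ Set.Icc 0 Real.pi) (l : ℕ) :
    limitAngle t l ∈ Set.Icc 0 Real.pi := by
  cases l with
  | zero => exact ht
  | succ l => exact ⟨Real.arccos_nonneg _, Real.arccos_le_pi _⟩

lemma limitAngle_zero (l : ℕ) : limitAngle 0 l = 0 := by
  induction l with
  | zero => rfl
  | succ l ih => rw [limitAngle, ih, two_mul_reluKernel_zero, Real.arccos_one]

lemma limitTrace_zero (l : ℕ) : limitTrace 0 l = l := by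
  induction l with
  | zero => simp [limitTrace]
  | succ l ih => simp [limitTrace, ih, limitAngle_zero, add_comm]

/-- This keeps the limiting cosine of the gradient angle in `[-1, 1]`, so that `Real.cos` undoes
`Real.arccos`. -/
lemma abs_limitTrace_le {t : ℝ} (ht : t ∈ Set.Icc 0 Real.pi) (l : ℕ) : |limitTrace t l| ≤ l := by
  induction l with
  | zero => simp [limitTrace]
  | succ l ih =>
    have h := limitAngle_mem_Icc ht l
    have h1 : |1 - limitAngle t l / Real.pi| ≤ 1 := by
      have h2 : 0 ≤ limitAngle t l / Real.pi := div_nonneg h.1 Real.pi_pos.le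
      have h3 : limitAngle t l / Real.pi ≤ 1 := (div_le_one Real.pi_pos).2 h.2
      rw [abs_le]
      constructor <;> linarith
    rw [limitTrace, abs_mul, Nat.cast_succ]
    have h4 : |Real.cos (limitAngle t l) + limitTrace t l| ≤ l + 1 :=
      (abs_add_le _ _).trans (by linarith [Real.abs_cos_le_one (limitAngle t l)])
    exact (mul_le_of_le_one_left (abs_nonneg _) h1).trans h4

/-- With `S_n` the left side, the trace recursion reads `S_{n+1} = cos θ_{n+1} + (1 - θ_n/π) S_n`;
the sum is its unrolled form. -/
lemma cos_add_limitTrace_eq_sum (t : ℝ) (n : ℕ) :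
    Real.cos (limitAngle t n) + limitTrace t n = ∑ l ∈ Finset.range (n + 1),
      (Real.cos (limitAngle t l) * ∏ k ∈ Finset.Ico l n, (1 - limitAngle t k / Real.pi)) := by
  induction n with
  | zero => simp [limitTrace]
  | succ n ih =>
    rw [Finset.sum_range_succ, limitTrace, ih, Finset.Ico_self, Finset.prod_empty, mul_one,
      add_comm, Finset.mul_sum]
    congr 1
    refine Finset.sum_congr rfl fun l hl => ?_
    rw [Finset.prod_Ico_succ_top (by simpa [Nat.lt_succ_iff] using hl)]
    ring

variable {d L : ℕ} {x z : EuclideanSpace ℝ (Fin d)}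

/-- The layer step with both inputs equal to `x`. The angle is then `0` as soon as the embedding is
nonzero, which the induction hypothesis makes true with probability tending to one. -/
lemma tendsto_norm_embedding (hx : x ≠ 0) {l : ℕ} (hl : l ≤ L) :
    Tendsto (fun p : Σ m, Param d m L => ‖embedding p.2 x l‖) (initFilter d L) (𝓝 ‖x‖) := by
  induction l with
  | zero => exact tendsto_const_nhds
  | succ l ih =>
    have h := ih (by omega)
    have hne : ∀ᶠ p : Σ m, Param d m L in initFilter d L, embedding p.2 x l ≠ 0 := by
      filter_upwards [h.eventually_ne (norm_ne_zero_iff.2 hx)] with p hp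
      exact norm_ne_zero_iff.1 hp
    have hθ : Tendsto (fun p : Σ m, Param d m L => embeddingAngle p.2 x x l) (initFilter d L)
        (𝓝 0) := by
      refine tendsto_const_nhds.congr' ?_
      filter_upwards [hne] with p hp
      rw [embeddingAngle, InnerProductGeometry.angle_self hp]
    have h2 := tendsto_inner_embedding_succ (by omega : l < L) h h hθ
    rw [two_mul_reluKernel_zero, mul_one] at h2
    have h3 := (Real.continuous_sqrt.tendsto _).comp h2
    rw [Real.sqrt_mul_self (norm_nonneg x)] at h3
    refine h3.congr fun p => ?_
    simp [Real.sqrt_sq]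

lemma eventually_embedding_ne_zero (hx : x ≠ 0) {l : ℕ} (hl : l ≤ L) :
    ∀ᶠ p : Σ m, Param d m L in initFilter d L, embedding p.2 x l ≠ 0 := by
  filter_upwards [(tendsto_norm_embedding hx hl).eventually_ne (norm_ne_zero_iff.2 hx)] with p hp
  exact norm_ne_zero_iff.1 hp

lemma tendsto_embeddingAngle (hx : x ≠ 0) (hz : z ≠ 0) {l : ℕ} (hl : l ≤ L) :
    Tendsto (fun p : Σ m, Param d m L => embeddingAngle p.2 x z l) (initFilter d L)
      (𝓝 (limitAngle (InnerProductGeometry.angle x z) l)) := by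
  induction l with
  | zero => exact tendsto_const_nhds
  | succ l ih =>
    have h := tendsto_inner_embedding_succ (by omega : l < L)
      (tendsto_norm_embedding hx (by omega : l ≤ L))
      (tendsto_norm_embedding hz (by omega : l ≤ L)) (ih (by omega))
    have hn : ‖x‖ * ‖z‖ ≠ 0 := mul_ne_zero (norm_ne_zero_iff.2 hx) (norm_ne_zero_iff.2 hz)
    have h2 := h.div ((tendsto_norm_embedding hx hl).mul (tendsto_norm_embedding hz hl)) hn
    rw [mul_div_cancel_left₀ _ hn] at h2
    exact (Real.continuous_arccos.tendsto _).comp h2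

lemma tendsto_inner_embedding (hx : x ≠ 0) (hz : z ≠ 0) {l : ℕ} (hl : l ≤ L) :
    Tendsto (fun p : Σ m, Param d m L => ⟪embedding p.2 x l, embedding p.2 z l⟫) (initFilter d L)
      (𝓝 (‖x‖ * ‖z‖ * Real.cos (limitAngle (InnerProductGeometry.angle x z) l))) := by
  refine (((tendsto_norm_embedding hx hl).mul (tendsto_norm_embedding hz hl)).mul
    ((Real.continuous_cos.tendsto _).comp (tendsto_embeddingAngle hx hz hl))).congr fun p => ?_
  rw [← InnerProductGeometry.cos_angle_mul_norm_mul_norm, mul_comm]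
  rfl

/-- The two limits are proved together: the trace step needs the Frobenius norm to vanish, and the
Frobenius step needs the trace to converge. The start is trivial, since the input does not depend on
the parameters. -/
lemma tendsto_kernelTrace_and_kernelNormSq (hx : x ≠ 0) (hz : z ≠ 0) {l : ℕ} (hl : l ≤ L) :
    Tendsto (fun p : Σ m, Param d m L => kernelTrace p.2 x z l) (initFilter d L)
      (𝓝 (‖x‖ * ‖z‖ * limitTrace (InnerProductGeometry.angle x z) l)) ∧
    Tendsto (fun p : Σ m, Param d m L => kernelNormSq p.2 x z l) (initFilter d L) (𝓝 0) := by
  induction l with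
  | zero =>
    simp [kernelTrace, kernelNormSq, tangentKernel, embeddingGradient, limitTrace]
    exact tendsto_const_nhds
  | succ l ih =>
    have hl' : l < L := by omega
    obtain ⟨hT, hF⟩ := ih hl'.le
    have hC := tendsto_inner_embedding hx hz hl'.le
    refine ⟨?_, tendsto_kernelNormSq_succ hl' hC hT hF⟩
    simp_rw [kernelTrace_succ hl']
    have h := ((tendsto_traceDeviation hl' hF).const_mul 2).add
      ((tendsto_activeFraction hl' (eventually_embedding_ne_zero hx hl'.le)
        (eventually_embedding_ne_zero hz hl'.le) (tendsto_embeddingAngle hx hz hl'.le)).mul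
        (hC.add hT))
    convert h using 2
    rw [limitTrace]
    ring

lemma eventually_modelGradient_eq (x : EuclideanSpace ℝ (Fin d)) :
    ∀ᶠ p : Σ m, Param d m L in initFilter d L, modelGradient p.2 x = formalGradient p.2 x :=
  eventually_initFilter_of_ae fun _ => ae_modelGradient_eq x

lemma tendsto_inner_modelGradient (hx : x ≠ 0) (hz : z ≠ 0) :
    Tendsto (fun p : Σ m, Param d m L => ⟪modelGradient p.2 x, modelGradient p.2 z⟫)
      (initFilter d L) (𝓝 (‖x‖ * ‖z‖ * (Real.cos (limitAngle (InnerProductGeometry.angle x z) L) +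
        limitTrace (InnerProductGeometry.angle x z) L))) := by
  have h := tendsto_kernelTrace_and_kernelNormSq hx hz (le_refl L)
  rw [mul_add]
  refine (tendsto_inner_formalGradient (tendsto_inner_embedding hx hz le_rfl) h.1 h.2).congr' ?_
  filter_upwards [eventually_modelGradient_eq x, eventually_modelGradient_eq z] with p h1 h2
  rw [h1, h2]

lemma embedding_zero_input {m : ℕ} (w : Param d m L) (l : ℕ) :
    embedding w (0 : EuclideanSpace ℝ (Fin d)) l = 0 := by
  induction l with
  | zero => rfl
  | succ l ih =>
    ext i
    simp [embedding_succ_apply, preactivation_eq_sum, ih, relu]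

lemma modelGradient_zero_input {m : ℕ} (w : Param d m L) :
    modelGradient w (0 : EuclideanSpace ℝ (Fin d)) = 0 := by
  have h : reluNetwork d m L 0 = fun _ => 0 := by
    ext w
    simp [reluNetwork, embedding_zero_input]
  rw [modelGradient, h, gradient_fun_const]

lemma tendsto_norm_modelGradient (x : EuclideanSpace ℝ (Fin d)) :
    Tendsto (fun p : Σ m, Param d m L => ‖modelGradient p.2 x‖) (initFilter d L)
      (𝓝 (Real.sqrt (L + 1) * ‖x‖)) := by
  by_cases hx : x = 0
  · subst hx
    simp only [modelGradient_zero_input, norm_zero, mul_zero]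
    exact tendsto_const_nhds
  · have h := tendsto_inner_modelGradient (L := L) hx hx
    rw [InnerProductGeometry.angle_self hx, limitAngle_zero, limitTrace_zero, Real.cos_zero] at h
    have h2 := (Real.continuous_sqrt.tendsto _).comp h
    rw [mul_comm, add_comm, Real.sqrt_mul (by positivity), Real.sqrt_mul_self (norm_nonneg x)] at h2
    refine h2.congr fun p => ?_
    simp [Real.sqrt_sq]

lemma tendsto_gradientAngle (hx : x ≠ 0) (hz : z ≠ 0) :
    Tendsto (fun p : Σ m, Param d m L => gradientAngle p.2 x z) (initFilter d L)
      (𝓝 (Real.arccos ((Real.cos (limitAngle (InnerProductGeometry.angle x z) L) +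
        limitTrace (InnerProductGeometry.angle x z) L) / (L + 1)))) := by
  have hx' := norm_ne_zero_iff.2 hx
  have hz' := norm_ne_zero_iff.2 hz
  have hL : (0 : ℝ) < (L : ℝ) + 1 := by positivity
  have hs : Real.sqrt (L + 1) ≠ 0 := (Real.sqrt_pos.2 hL).ne'
  have h := (tendsto_inner_modelGradient (L := L) hx hz).div
    ((tendsto_norm_modelGradient x).mul (tendsto_norm_modelGradient z))
    (mul_ne_zero (mul_ne_zero hs hx') (mul_ne_zero hs hz'))
  rw [mul_mul_mul_comm, Real.mul_self_sqrt hL.le, mul_comm ((L : ℝ) + 1),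
    mul_div_mul_left _ _ (mul_ne_zero hx' hz')] at h
  exact (Real.continuous_arccos.tendsto _).comp h

lemma exists_limit_angles (x z : EuclideanSpace ℝ (Fin d)) : ∃ (θ : ℕ → ℝ) (φ : ℝ),
    (∀ l ≤ L, TendstoInProbAtInit d L (fun _ w => embeddingAngle w x z l) (θ l)) ∧
    TendstoInProbAtInit d L (fun _ w => gradientAngle w x z) φ ∧
    Real.cos φ = 1 / ((L : ℝ) + 1) * ∑ l ∈ Finset.range (L + 1),
      (Real.cos (θ l) * ∏ l' ∈ Finset.Ico l L, (1 - θ l' / Real.pi)) := by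
  simp only [tendstoInProbAtInit_iff]
  by_cases h0 : x = 0 ∨ z = 0
  -- A zero input has zero embeddings and zero gradient, so every angle is `π / 2` by convention,
  -- and both sides of the formula are `0`.
  · refine ⟨fun _ => Real.pi / 2, Real.pi / 2, fun l _ => ?_, ?_, by simp⟩
    · refine tendsto_const_nhds.congr fun p => ?_
      rcases h0 with rfl | rfl <;> simp [embeddingAngle, embedding_zero_input]
    · refine tendsto_const_nhds.congr fun p => ?_
      rcases h0 with rfl | rfl <;> simp [gradientAngle, modelGradient_zero_input]
  · rw [not_or] at h0
    set t := InnerProductGeometry.angle x z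
    have ht : t ∈ Set.Icc 0 Real.pi :=
      ⟨InnerProductGeometry.angle_nonneg x z, InnerProductGeometry.angle_le_pi x z⟩
    refine ⟨limitAngle t, _, fun l hl => tendsto_embeddingAngle h0.1 h0.2 hl,
      tendsto_gradientAngle h0.1 h0.2, ?_⟩
    have hL : (0 : ℝ) < (L : ℝ) + 1 := by positivity
    have hb : |Real.cos (limitAngle t L) + limitTrace t L| ≤ L + 1 :=
      (abs_add_le _ _).trans (by
        linarith [Real.abs_cos_le_one (limitAngle t L), abs_limitTrace_le ht L])
    rw [abs_le] at hb
    rw [Real.cos_arccos (by rw [le_div_iff₀ hL]; linarith) (by rw [div_le_one hL]; linarith),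
      cos_add_limitTrace_eq_sum, one_div, div_eq_inv_mul]

end Limit

theorem mainTheorem4 (d L : ℕ) :
    (∀ (x : EuclideanSpace ℝ (Fin d)) (m : ℕ),
      ∀ᵐ w ∂(initMeasure d m L), DifferentiableAt ℝ (reluNetwork d m L x) w) ∧
    (∀ x z : EuclideanSpace ℝ (Fin d), ∃ (θ : ℕ → ℝ) (φ : ℝ),
      (∀ l ≤ L, TendstoInProbAtInit d L (fun _ w => embeddingAngle w x z l) (θ l)) ∧
      TendstoInProbAtInit d L (fun _ w => gradientAngle w x z) φ ∧
      Real.cos φ = 1 / ((L : ℝ) + 1) * ∑ l ∈ Finset.range (L + 1),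
        (Real.cos (θ l) * ∏ l' ∈ Finset.Ico l L, (1 - θ l' / Real.pi))) ∧
    (∀ x : EuclideanSpace ℝ (Fin d),
      TendstoInProbAtInit d L (fun _ w => ‖modelGradient w x‖)
        (Real.sqrt ((L : ℝ) + 1) * ‖x‖)) :=
  ⟨fun x _ => ae_differentiableAt_reluNetwork x, exists_limit_angles,
    fun x => tendstoInProbAtInit_iff.2 (tendsto_norm_modelGradient x)⟩
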